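/- Let $U:\mathbb R^N\to\mathbb R$ be $C^1$, and $C^3$ on $\mathbb R^N\setminus\{x^*\}$, where $x^*$ is the unique point with $\nabla U(x^*)=0$; assume that $\nabla^2U(x)$ is positive definite for all $x\ne x^*$ and that $U(x)\to\infty$ as $|x|\to\infty$. Assume diagonal dominance in the tangency coordinates: for every $x\neq x^*$ and every $j$ with $\partial_jU(x)=0$, $$\partial_j^2U(x)-\sum_{k\ne j}|\partial_j\partial_kU(x)|>0 .$$ For $\varepsilon>0$ let $(X^\varepsilon_t,V^\varepsilon_t)_{t\ge0}$ be the Zig-Zag Sampler for the potential $\varepsilon^{-1}U$, started at $(x,v)\in\mathbb R^N\times\{-1,1\}^N$: the position moves with $\dot X^\varepsilon=V^\varepsilon$ and, for each $j$, the $j$-th velocity coordinate changes sign at rate $\varepsilon^{-1}(V^\varepsilon_j\,\partial_jU(X^\varepsilon))_+$. For $\gamma\in(0,1)$ put $B_\gamma=\{y:U(x^*)+\gamma\le U(y)\le U(x^*)+\gamma^{-1}\}$ and $\tau^\varepsilon=\inf\{t\ge0:X^\varepsilon_t\notin B_\gamma\}$, and let $N^\varepsilon_{i,T}$ be the number of sign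 changes of the $i$-th velocity coordinate during $[0,T\wedge\tau^\varepsilon]$. Fix $\gamma\in(0,1)$, $T>0$ and a coordinate $i$. Then there is a constant $C>0$ such that: (i) for all sufficiently small $\varepsilon>0$, all starting points $x$ with $\partial_iU(x)=0$ and $U(x^*)+\gamma<U(x)<U(x^*)+\gamma^{-1}$, and all initial velocities $v\in\{-1,1\}^N$, $$\mathbb E\bigl[N^\varepsilon_{i,T}\bigr]\le C\,\varepsilon^{-1/2} \qquad\text{and}\qquad \mathbb E\Bigl[\sup_{0\le t\le T\wedge\tau^\varepsilon}|\partial_iU(X^\varepsilon_t)|\Bigr]\le C\,\varepsilon^{1/4};$$ (ii) for all $a,b$ with $U(x^*)+\gamma<a$ and $b<U(x^*)+\gamma^{-1}$ there is a constant $c\in(0,C)$ such that, for all sufficiently small $\varepsilon>0$, all starting points $x$ with $\partial_iU(x)=0$ and $a\le U(x)\le b$, and all $v\in\{-1,1\}^N$, $$\mathbb E\bigl[N^\varepsilon_{i,T}\bigr]\ge c\,\varepsilon^{-1/2}.$$ In particular, if starting points $x^\varepsilon$ with $\partial_iU(x^\varepsilon)=0$ converge, as $\varepsilon\to0$, to a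 point $x$ with $U(x^*)+\gamma<U(x)<U(x^*)+\gamma^{-1}$, then $c\,\varepsilon^{-1/2}\le\mathbb E[N^\varepsilon_{i,T}]\le C\,\varepsilon^{-1/2}$ for all sufficiently small $\varepsilon$. -/

import Mathlib

open MeasureTheory ProbabilityTheory Set Filter Topology
open scoped ENNReal

noncomputable section

namespace ZigZag

variable {N : ℕ}

/-- The partial derivative `∂ᵢU(x)`. -/
def pd (U : EuclideanSpace ℝ (Fin N) → ℝ) (i : Fin N) (x : EuclideanSpace ℝ (Fin N)) : ℝ :=
  fderiv ℝ U x (EuclideanSpace.single i 1)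

/-- The Hessian matrix `(∂ⱼ∂ᵢU(x))ᵢⱼ`. -/
def hess (U : EuclideanSpace ℝ (Fin N) → ℝ) (x : EuclideanSpace ℝ (Fin N)) :
    Matrix (Fin N) (Fin N) ℝ :=
  Matrix.of fun i j => pd (pd U i) j x

/-- The standing assumption on the potential `U` with minimiser `xs`: `U` is `C¹`, and `C³` away
from `xs`; `xs` is the unique critical point; the Hessian is positive definite away from `xs`;
and `U(x) → ∞` as `|x| → ∞`. -/
structure IsPotential (U : EuclideanSpace ℝ (Fin N) → ℝ) (xs : EuclideanSpace ℝ (Fin N)) :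
    Prop where
  contDiff_one : ContDiff ℝ 1 U
  contDiffOn_three : ContDiffOn ℝ 3 U {xs}ᶜ
  critical_iff : ∀ x, fderiv ℝ U x = 0 ↔ x = xs
  hess_posDef : ∀ x, x ≠ xs → (hess U x).PosDef
  coercive : Tendsto U (cocompact (EuclideanSpace ℝ (Fin N))) atTop

/-- Diagonal dominance in the tangency coordinates: at every point `x ≠ xs`, each row `i` of the
Hessian with `∂ᵢU(x) = 0` is strictly diagonally dominant (with positive diagonal entry). -/
def DiagDominant (U : EuclideanSpace ℝ (Fin N) → ℝ) (xs : EuclideanSpace ℝ (Fin N)) : Prop :=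
  ∀ x, x ≠ xs → ∀ i, pd U i x = 0 →
    0 < hess U x i i - ∑ j ∈ Finset.univ.erase i, |hess U x i j|

/-- The energy band `{x : U(xs) + γ ≤ U(x) ≤ U(xs) + γ⁻¹}`. -/
def band (U : EuclideanSpace ℝ (Fin N) → ℝ) (xs : EuclideanSpace ℝ (Fin N)) (γ : ℝ) :
    Set (EuclideanSpace ℝ (Fin N)) :=
  {x | U xs + γ ≤ U x ∧ U x ≤ U xs + γ⁻¹}

/-- The switching rate `ε⁻¹ (vᵢ ∂ᵢU(x))₊` of coordinate `i` for the potential `ε⁻¹ U`. -/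
def rate (U : EuclideanSpace ℝ (Fin N) → ℝ) (ε : ℝ) (i : Fin N)
    (x v : EuclideanSpace ℝ (Fin N)) : ℝ :=
  ε⁻¹ * max (v i * pd U i x) 0

/-- The time at which coordinate `i` rings along the free flight `x + s v`: the first `t ≥ 0` at
which the integrated rate reaches the level `e`, and `∞` if it never does. If `e` is standard
exponential, it exceeds `t` with probability `exp (-∫₀ᵗ rate)`. -/
def ringTime (U : EuclideanSpace ℝ (Fin N) → ℝ) (ε : ℝ) (i : Fin N)
    (x v : EuclideanSpace ℝ (Fin N)) (e : ℝ) : ℝ≥0∞ :=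
  ⨅ (t : ℝ) (_ : 0 ≤ t ∧ e ≤ ∫ s in (0 : ℝ)..t, rate U ε i (x + s • v) v), ENNReal.ofReal t

/-- The first ringing time over all coordinates, for clock levels `e`. -/
def waitTime (U : EuclideanSpace ℝ (Fin N) → ℝ) (ε : ℝ)
    (x v : EuclideanSpace ℝ (Fin N)) (e : Fin N → ℝ) : ℝ≥0∞ :=
  ⨅ i, ringTime U ε i x v (e i)

/-- The velocity after the first ringing: the coordinate that rings first changes sign (ties have
probability zero). -/
def flip (U : EuclideanSpace ℝ (Fin N) → ℝ) (ε : ℝ)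
    (x v : EuclideanSpace ℝ (Fin N)) (e : Fin N → ℝ) : EuclideanSpace ℝ (Fin N) :=
  open Classical in
  WithLp.toLp 2 fun i => if ringTime U ε i x v (e i) = waitTime U ε x v e then -v i else v i

/-- The skeleton of the Zig-Zag process started at `(x, v)`: the time of the `n`-th event (time `0`
for `n = 0`, and `∞` if there are fewer than `n` events), with the position and the velocity right
after it. The `n`-th flight uses the clock levels `ω (n, i)`, `i = 1, …, N`. -/
def skeleton (U : EuclideanSpace ℝ (Fin N) → ℝ) (ε : ℝ)
    (x v : EuclideanSpace ℝ (Fin N)) (ω : ℕ × Fin N → ℝ) :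
    ℕ → ℝ≥0∞ × EuclideanSpace ℝ (Fin N) × EuclideanSpace ℝ (Fin N)
  | 0 => (0, x, v)
  | n + 1 =>
    let z := skeleton U ε x v ω n
    let e : Fin N → ℝ := fun i => ω (n, i)
    let S := waitTime U ε z.2.1 z.2.2 e
    (z.1 + S, z.2.1 + S.toReal • z.2.2, flip U ε z.2.1 z.2.2 e)

/-- The index of the last event up to time `t`. -/
def eventIndex (U : EuclideanSpace ℝ (Fin N) → ℝ) (ε : ℝ)
    (x v : EuclideanSpace ℝ (Fin N)) (ω : ℕ × Fin N → ℝ) (t : ℝ) : ℕ :=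
  sSup {n | (skeleton U ε x v ω n).1 ≤ ENNReal.ofReal t}

/-- The velocity `V^ε(t)` of the Zig-Zag process. -/
def vel (U : EuclideanSpace ℝ (Fin N) → ℝ) (ε : ℝ)
    (x v : EuclideanSpace ℝ (Fin N)) (ω : ℕ × Fin N → ℝ) (t : ℝ) : EuclideanSpace ℝ (Fin N) :=
  (skeleton U ε x v ω (eventIndex U ε x v ω t)).2.2

/-- The position `X^ε(t)` of the Zig-Zag process: free flight since the last event. -/
def pos (U : EuclideanSpace ℝ (Fin N) → ℝ) (ε : ℝ)
    (x v : EuclideanSpace ℝ (Fin N)) (ω : ℕ × Fin N → ℝ) (t : ℝ) : EuclideanSpace ℝ (Fin N) :=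
  let z := skeleton U ε x v ω (eventIndex U ε x v ω t)
  z.2.1 + (t - z.1.toReal) • z.2.2

/-- The law of the clock levels: independent standard exponential variables. -/
def clockMeasure (N : ℕ) : Measure (ℕ × Fin N → ℝ) :=
  Measure.infinitePi fun _ => expMeasure 1

/-- The first exit time `τ^ε` of the position from the energy band (`∞` if it never exits). -/
def exitTime (U : EuclideanSpace ℝ (Fin N) → ℝ) (xs : EuclideanSpace ℝ (Fin N)) (γ ε : ℝ)
    (x v : EuclideanSpace ℝ (Fin N)) (ω : ℕ × Fin N → ℝ) : ℝ≥0∞ :=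
  ⨅ (t : ℝ) (_ : 0 ≤ t ∧ pos U ε x v ω t ∉ band U xs γ), ENNReal.ofReal t

/-- The time interval `[0, T ∧ τ^ε]`. -/
def stoppedInterval (U : EuclideanSpace ℝ (Fin N) → ℝ) (xs : EuclideanSpace ℝ (Fin N))
    (γ ε T : ℝ) (x v : EuclideanSpace ℝ (Fin N)) (ω : ℕ × Fin N → ℝ) : Set ℝ :=
  {t | 0 ≤ t ∧ t ≤ T ∧ ENNReal.ofReal t ≤ exitTime U xs γ ε x v ω}

/-- The number `N_{i,T}^ε` of flips of coordinate `i` of the velocity up to time `T ∧ τ^ε`. -/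
def flipCount (U : EuclideanSpace ℝ (Fin N) → ℝ) (xs : EuclideanSpace ℝ (Fin N))
    (γ ε T : ℝ) (i : Fin N) (x v : EuclideanSpace ℝ (Fin N)) (ω : ℕ × Fin N → ℝ) : ℕ∞ :=
  Set.encard {s | s ∈ stoppedInterval U xs γ ε T x v ω ∧ 0 < s ∧
    vel U ε x v ω s i ≠ Function.leftLim (fun t => vel U ε x v ω t i) s}

/-- `sup |∂ᵢU(X^ε(t))|` over `0 ≤ t ≤ T ∧ τ^ε`. -/
def supPartial (U : EuclideanSpace ℝ (Fin N) → ℝ) (xs : EuclideanSpace ℝ (Fin N))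
    (γ ε T : ℝ) (i : Fin N) (x v : EuclideanSpace ℝ (Fin N)) (ω : ℕ × Fin N → ℝ) : ℝ≥0∞ :=
  ⨆ t ∈ stoppedInterval U xs γ ε T x v ω, ENNReal.ofReal |pd U i (pos U ε x v ω t)|

end ZigZag

end

noncomputable section

namespace ZigZag

variable {N : ℕ}

/-! Let Z = Vᵢ ∂ᵢU(X). On the band, which is compact and avoids `xs`, Z grows along flights at rate
at most K. Diagonal dominance and compactness give a rate of at least δ > 0 as long as |Z| ≤ η.
Coordinate i rings at rate Z₊/ε, only when Z ≥ 0, and a ring replaces Z by -Z. The other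
coordinates' rings leave Z continuous and change only its slope. So Z is pushed upwards near 0 and
reflected down by rings, typically at height √ε.

Two deterministic telescopings carry the argument. Summing Z itself, a ring costs 2Z, so the ring
heights add up to at most (M + KT)/2 (`ringSum_le`). Summing Z₊², a ring wipes it out, and its
growth is at most 2K Z₊ dt. Hence both the sum of the squared ring heights and sup Z₊² are at most
2KA, where A = ∫ Z₊ dt is the area (`Active.jumpSum_two_le`).

The probability enters through one compensator identity (`lintegral_rings`): the expected sum of
g(Z) over rings is the expected integral of ε⁻¹ Z₊ g(Z). With g = 1 it gives E[rings] = ε⁻¹ E[A].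
With g(z) = z₊ it bounds ε⁻¹ E∫ Z₊² by the expected sum of heights, and z ≤ √ε/2 + (√ε/2) ε⁻¹ z²
then gives E[A] = O(√ε). This proves the upper bound on the number of rings. With sup Z₊ ≤ √(2KA) it
also gives the order ε^(1/4) of the supremum; on the negative side, -w is a barrier for every level
w ≤ η that dominates Z₊, because Z has positive slope there.

For the lower bound, take a time T' so short that the band cannot be left. The slope bound δ forces
the ring heights to total about δT'/2. By Cauchy–Schwarz in the form 2z ≤ l + z²/l, this total is
controlled by l times the number of rings plus 2KA/l. Choosing l of order √ε makes the area term a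
small part of δT', so the number of rings has expectation at least of order 1/√ε. -/

/-- The first time `t ≥ 0` at which the integral of `lam` over `[0, t]` reaches the level `e`. -/
def hitTime (lam : ℝ → ℝ) (e : ℝ) : ℝ≥0∞ :=
  ⨅ (t : ℝ) (_ : 0 ≤ t ∧ e ≤ ∫ s in (0 : ℝ)..t, lam s), ENNReal.ofReal t

/-! ### A single clock: hitting times of an integrated rate and their compensator. -/

section HitTime

variable {lam : ℝ → ℝ}

theorem hasDerivAt_primitive (hc : Continuous lam) (t : ℝ) :
    HasDerivAt (fun t => ∫ s in (0 : ℝ)..t, lam s) (lam t) t :=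
  intervalIntegral.integral_hasDerivAt_right (hc.intervalIntegrable _ _)
    (hc.stronglyMeasurableAtFilter _ _) hc.continuousAt

theorem continuous_primitive (hc : Continuous lam) :
    Continuous fun t => ∫ s in (0 : ℝ)..t, lam s :=
  continuous_iff_continuousAt.2 fun t => (hasDerivAt_primitive hc t).continuousAt

theorem monotone_primitive (hc : Continuous lam) (h0 : ∀ s, 0 ≤ lam s) :
    Monotone fun t => ∫ s in (0 : ℝ)..t, lam s :=
  monotone_of_hasDerivAt_nonneg (hasDerivAt_primitive hc) h0

/-- The infimum is attained because the primitive is continuous and nondecreasing; this turns every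
event about hitting times into an inequality between real numbers. -/
theorem hitTime_le_iff (hc : Continuous lam) (h0 : ∀ s, 0 ≤ lam s) {e t : ℝ} (ht : 0 ≤ t) :
    hitTime lam e ≤ ENNReal.ofReal t ↔ e ≤ ∫ s in (0 : ℝ)..t, lam s := by
  refine ⟨fun h => ?_, fun h => iInf₂_le (f := fun t _ => ENNReal.ofReal t) t ⟨ht, h⟩⟩
  by_contra! hlt
  have hev : ∀ᶠ t' in 𝓝[>] t, ∫ s in (0 : ℝ)..t', lam s < e :=
    ((continuous_primitive hc).continuousAt.eventually_lt continuousAt_const hlt).filter_mono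
      nhdsWithin_le_nhds
  obtain ⟨t', ht', htt'⟩ := (hev.and self_mem_nhdsWithin).exists
  have htt' : t < t' := htt'
  have : ENNReal.ofReal t' ≤ hitTime lam e := by
    refine le_iInf₂ fun s hs => ENNReal.ofReal_le_ofReal ?_
    by_contra! hst
    exact absurd (hs.2.trans (monotone_primitive hc h0 hst.le)) (not_le.2 ht')
  exact absurd (this.trans h) (not_le.2 ((ENNReal.ofReal_lt_ofReal_iff (ht.trans_lt htt')).2 htt'))

theorem lt_hitTime_iff (hc : Continuous lam) (h0 : ∀ s, 0 ≤ lam s) {e t : ℝ} (ht : 0 ≤ t) :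
    ENNReal.ofReal t < hitTime lam e ↔ ∫ s in (0 : ℝ)..t, lam s < e := by
  rw [← not_le, hitTime_le_iff hc h0 ht, not_le]

theorem hitTime_pos (hc : Continuous lam) (h0 : ∀ s, 0 ≤ lam s) {e : ℝ} (he : 0 < e) :
    0 < hitTime lam e := by
  have := (lt_hitTime_iff hc h0 (e := e) le_rfl).2 (by simpa using he)
  simpa using this

/-- The level reached at the current time is hit now if the rate is currently positive. -/
theorem hitTime_primitive (hc : Continuous lam) (h0 : ∀ s, 0 ≤ lam s) {s : ℝ} (hs : 0 ≤ s)
    (hpos : 0 < lam s) : hitTime lam (∫ r in (0 : ℝ)..s, lam r) = ENNReal.ofReal s := by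
  refine le_antisymm ((hitTime_le_iff hc h0 hs).2 le_rfl) (le_iInf₂ fun t ht => ?_)
  refine ENNReal.ofReal_le_ofReal ?_
  by_contra! hts
  have hp : 0 < ∫ r in t..s, lam r :=
    intervalIntegral.integral_pos hts hc.continuousOn (fun x _ => h0 x)
      ⟨s, right_mem_Icc.2 hts.le, hpos⟩
  have := intervalIntegral.integral_add_adjacent_intervals (hc.intervalIntegrable 0 t)
    (hc.intervalIntegrable (μ := volume) t s)
  linarith [ht.2]

/-- At the hitting time of a positive level the driving function is not negative. -/
theorem nonneg_at_hitTime {z : ℝ → ℝ} {a : ℝ} (hz : Continuous z) (ha : 0 ≤ a) {e : ℝ}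
    (he : 0 < e) (hfin : hitTime (fun s => a * max (z s) 0) e ≠ ∞) :
    0 ≤ z (hitTime (fun s => a * max (z s) 0) e).toReal := by
  set lam : ℝ → ℝ := fun s => a * max (z s) 0
  have hc : Continuous lam := by fun_prop
  have h0 : ∀ s, 0 ≤ lam s := fun s => by positivity
  set r := (hitTime lam e).toReal with hr
  -- A positive level leaves room to the left of r. If z were negative at r, the rate would vanish
  -- just before r, so the level would already have been reached earlier.
  have hrpos : 0 < r := ENNReal.toReal_pos (hitTime_pos hc h0 he).ne' hfin
  by_contra! hneg
  have hev : ∀ᶠ t in 𝓝 r, z t < 0 := hz.continuousAt.eventually_lt continuousAt_const hneg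
  obtain ⟨δ, hδ, hball⟩ := Metric.eventually_nhds_iff.1 hev
  obtain ⟨t, ht1, ht2⟩ := exists_between (max_lt hrpos (sub_lt_self r hδ))
  have ht0 : 0 < t := (le_max_left _ _).trans_lt ht1
  have htr : r - δ < t := (le_max_right _ _).trans_lt ht1
  have hzero : ∫ s in t..r, lam s = 0 := by
    rw [intervalIntegral.integral_congr (g := fun _ => 0)]
    · simp
    · intro s hs
      rw [uIcc_of_le ht2.le] at hs
      have : z s < 0 := hball (by
        rw [Real.dist_eq, abs_lt]; constructor <;> linarith [hs.1, hs.2])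
      simp [lam, max_eq_right this.le]
  have hle : e ≤ ∫ s in (0 : ℝ)..r, lam s :=
    (hitTime_le_iff hc h0 hrpos.le).1 (by rw [hr, ENNReal.ofReal_toReal hfin])
  have hadd := intervalIntegral.integral_add_adjacent_intervals (hc.intervalIntegrable 0 t)
    (hc.intervalIntegrable (μ := volume) t r)
  have := (hitTime_le_iff hc h0 ht0.le).2 (by linarith : e ≤ ∫ s in (0 : ℝ)..t, lam s)
  have h2 := ENNReal.toReal_mono ENNReal.ofReal_ne_top this
  rw [ENNReal.toReal_ofReal ht0.le] at h2
  linarith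

theorem expMeasure_Ioi {t : ℝ} (ht : 0 ≤ t) :
    expMeasure 1 (Ioi t) = ENNReal.ofReal (Real.exp (-t)) := by
  have := isProbabilityMeasure_expMeasure one_pos
  have h := cdf_expMeasure_eq one_pos t
  rw [cdf_eq_real, if_pos ht, one_mul] at h
  have h2 : (expMeasure 1).real (Ioi t) = Real.exp (-t) := by
    rw [← compl_Iic, probReal_compl_eq_one_sub measurableSet_Iic, h]; ring
  rw [← h2, ofReal_measureReal]

/-- The expected value of a function of the ringing time, up to a horizon `d`. -/
theorem lintegral_hitTime_left (hc : Continuous lam) (h0 : ∀ s, 0 ≤ lam s) (g : ℝ → ℝ≥0∞)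
    (hm : Measurable (hitTime lam)) (hg : Measurable g) {d : ℝ} (hd : 0 ≤ d) :
    ∫⁻ u, {u | hitTime lam u ≤ ENNReal.ofReal d}.indicator
        (fun u => g (hitTime lam u).toReal) u ∂(expMeasure 1)
      = ∫⁻ s in Icc 0 d, ENNReal.ofReal (lam s) *
          (ENNReal.ofReal (Real.exp (-∫ r in (0 : ℝ)..s, lam r)) * g s) := by
  set P : ℝ → ℝ := fun t => ∫ r in (0 : ℝ)..t, lam r
  have hset : {u | hitTime lam u ≤ ENNReal.ofReal d} = Iic (P d) := by
    ext u; exact hitTime_le_iff hc h0 hd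
  have hP0 : P 0 = 0 := by simp [P]
  have hmono : Monotone P := monotone_primitive hc h0
  have himage : P '' Icc 0 d = Icc 0 (P d) := by
    refine Subset.antisymm ?_ ?_
    · rintro _ ⟨s, hs, rfl⟩
      exact ⟨hP0 ▸ hmono hs.1, hmono hs.2⟩
    · have := intermediate_value_Icc hd (continuous_primitive hc).continuousOn
      rwa [show (∫ r in (0 : ℝ)..0, lam r) = 0 by simp] at this
  have hexp : (expMeasure 1) = volume.withDensity (exponentialPDF 1) := rfl
  have hmG : Measurable ((Iic (P d)).indicator fun u => g (hitTime lam u).toReal) :=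
    (hg.comp hm.ennreal_toReal).indicator measurableSet_Iic
  have hmpdf : Measurable (exponentialPDF 1) :=
    (measurable_exponentialPDFReal 1).ennreal_ofReal
  rw [hset, hexp, lintegral_withDensity_eq_lintegral_mul _ hmpdf hmG]
  have : ∀ u, (exponentialPDF 1 * (Iic (P d)).indicator fun u => g (hitTime lam u).toReal) u
      = (Icc 0 (P d)).indicator
        (fun u => ENNReal.ofReal (Real.exp (-u)) * g (hitTime lam u).toReal) u := by
    intro u
    rw [Pi.mul_apply]
    by_cases hu : 0 ≤ u
    · rw [exponentialPDF_of_nonneg hu]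
      by_cases hu2 : u ≤ P d
      · rw [indicator_of_mem (show u ∈ Iic (P d) from hu2),
          indicator_of_mem (show u ∈ Icc 0 (P d) from ⟨hu, hu2⟩), one_mul, one_mul]
      · rw [indicator_of_notMem (show u ∉ Iic (P d) from hu2),
          indicator_of_notMem (show u ∉ Icc 0 (P d) from fun h => hu2 h.2)]; simp
    · rw [exponentialPDF_of_neg (not_le.1 hu), indicator_of_notMem (show u ∉ Icc 0 (P d) from
        fun h => hu h.1)]; simp
  simp_rw [this]
  rw [lintegral_indicator measurableSet_Icc, ← himage,
    -- Substitution u = P(s), which needs monotonicity only. Where P is flat, hitting P(s) need not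
    -- happen at s, but there the factor `lam s` is zero.
    lintegral_image_eq_lintegral_deriv_mul_of_monotoneOn measurableSet_Icc
      (fun s _ => (hasDerivAt_primitive hc s).hasDerivWithinAt) (hmono.monotoneOn _)]
  refine setLIntegral_congr_fun measurableSet_Icc fun s hs => ?_
  rcases (h0 s).eq_or_lt with h | h
  · simp [← h]
  · rw [hitTime_primitive hc h0 hs.1 h, ENNReal.toReal_ofReal hs.1]

/-- The expected accumulated rate up to the ringing time, weighted by `g`. -/
theorem lintegral_hitTime_right (hc : Continuous lam) (h0 : ∀ s, 0 ≤ lam s) (g : ℝ → ℝ≥0∞)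
    (hg : Measurable g) (d : ℝ) :
    ∫⁻ u, (∫⁻ s in Ioo 0 (min (hitTime lam u) (ENNReal.ofReal d)).toReal,
        ENNReal.ofReal (lam s) * g s) ∂(expMeasure 1)
      = ∫⁻ s in Icc 0 d, ENNReal.ofReal (lam s) *
          (ENNReal.ofReal (Real.exp (-∫ r in (0 : ℝ)..s, lam r)) * g s) := by
  set P : ℝ → ℝ := fun t => ∫ r in (0 : ℝ)..t, lam r
  have hPc : Continuous P := continuous_primitive hc
  have hmono : Monotone P := monotone_primitive hc h0
  have := isProbabilityMeasure_expMeasure one_pos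
  have hkey : ∀ u, (∫⁻ s in Ioo 0 (min (hitTime lam u) (ENNReal.ofReal d)).toReal,
        ENNReal.ofReal (lam s) * g s) = ∫⁻ s in Ioo 0 d,
          {q : ℝ × ℝ | P q.2 < q.1}.indicator (fun q => ENNReal.ofReal (lam q.2) * g q.2)
            (u, s) := by
    intro u
    rw [← lintegral_indicator measurableSet_Ioo, ← lintegral_indicator measurableSet_Ioo]
    refine lintegral_congr fun s => ?_
    have hfin : min (hitTime lam u) (ENNReal.ofReal d) ≠ ∞ :=
      ((min_le_right _ _).trans_lt ENNReal.ofReal_lt_top).ne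
    have hiff : 0 < s → (s < (min (hitTime lam u) (ENNReal.ofReal d)).toReal ↔
        P s < u ∧ s < d) := by
      intro hs
      rw [← ENNReal.ofReal_lt_iff_lt_toReal hs.le hfin, lt_min_iff,
        lt_hitTime_iff hc h0 hs.le, ENNReal.ofReal_lt_ofReal_iff_of_nonneg hs.le]
    by_cases hs : 0 < s
    · by_cases h1 : s < d <;> by_cases h2 : P s < u <;>
        simp [indicator, hs, h1, h2, hiff hs]
    · simp [indicator, hs]
  simp_rw [hkey]
  have hmset : MeasurableSet {q : ℝ × ℝ | P q.2 < q.1} :=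
    measurableSet_lt (hPc.measurable.comp measurable_snd) measurable_fst
  -- Tonelli: for fixed s, the level u survives s exactly when u > P(s), with probability
  -- exp(-P(s)).
  rw [lintegral_lintegral_swap]
  · rw [setLIntegral_congr Ioo_ae_eq_Icc]
    refine setLIntegral_congr_fun measurableSet_Icc fun s hs => ?_
    have hPs : 0 ≤ P s := by
      have := hmono hs.1
      simpa [P] using this
    have : ∀ u, {q : ℝ × ℝ | P q.2 < q.1}.indicator
        (fun q => ENNReal.ofReal (lam q.2) * g q.2) (u, s)
        = (Ioi (P s)).indicator (fun _ => ENNReal.ofReal (lam s) * g s) u := by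
      intro u; by_cases h : P s < u <;> simp [indicator, h]
    simp only [this]
    rw [lintegral_indicator measurableSet_Ioi, lintegral_const, Measure.restrict_apply_univ,
      expMeasure_Ioi hPs]
    ring
  · refine Measurable.aemeasurable (Measurable.indicator ?_ hmset)
    exact ((hc.measurable.comp measurable_snd).ennreal_ofReal).mul (hg.comp measurable_snd)

/-- Both sides equal the integral of λ e^{-P} g over [0, d]: on the left it is the density of the
ringing time, on the right the rate times the probability of not having rung yet. -/
theorem lintegral_hitTime (hc : Continuous lam) (h0 : ∀ s, 0 ≤ lam s) (g : ℝ → ℝ≥0∞)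
    (hm : Measurable (hitTime lam)) (hg : Measurable g) {d : ℝ} (hd : 0 ≤ d) :
    ∫⁻ u, {u | hitTime lam u ≤ ENNReal.ofReal d}.indicator
        (fun u => g (hitTime lam u).toReal) u ∂(expMeasure 1)
      = ∫⁻ u, (∫⁻ s in Ioo 0 (min (hitTime lam u) (ENNReal.ofReal d)).toReal,
          ENNReal.ofReal (lam s) * g s) ∂(expMeasure 1) :=
  (lintegral_hitTime_left hc h0 g hm hg hd).trans (lintegral_hitTime_right hc h0 g hg d).symm

/-- A family of hitting times is jointly measurable if its primitives are. -/
theorem measurable_hitTime {α : Type*} [MeasurableSpace α] {lam : α → ℝ → ℝ} {e : α → ℝ}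
    (hc : ∀ a, Continuous (lam a)) (h0 : ∀ a s, 0 ≤ lam a s)
    (hm : ∀ t, Measurable fun a => ∫ s in (0 : ℝ)..t, lam a s) (he : Measurable e) :
    Measurable fun a => hitTime (lam a) (e a) := by
  refine measurable_of_Iic fun c => ?_
  by_cases hctop : c = ∞
  · simp [hctop]
  · have : (fun a => hitTime (lam a) (e a)) ⁻¹' Iic c
        = {a | e a ≤ ∫ s in (0 : ℝ)..c.toReal, lam a s} := by
      ext a
      rw [mem_preimage, mem_Iic, mem_ofPred_eq,
        ← hitTime_le_iff (hc a) (h0 a) ENNReal.toReal_nonneg, ENNReal.ofReal_toReal hctop]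
    rw [this]
    exact measurableSet_le he (hm _)

end HitTime

/-! ### Flights cut at the time horizon and at the exit from a region, and their measurability. -/

/-- The signed partial derivative `vᵢ ∂ᵢU` along the free flight `x + s v`. -/
def drive (U : EuclideanSpace ℝ (Fin N) → ℝ) (i : Fin N) (x v : EuclideanSpace ℝ (Fin N))
    (s : ℝ) : ℝ :=
  v i * pd U i (x + s • v)

/-- The first exit time of the free flight `x + s v` from the region `B`. -/
def exitRay (B : Set (EuclideanSpace ℝ (Fin N))) (x v : EuclideanSpace ℝ (Fin N)) : ℝ≥0∞ :=
  ⨅ (s : ℝ) (_ : 0 ≤ s ∧ x + s • v ∉ B), ENNReal.ofReal s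

/-- The duration of the `n`-th flight. -/
def flightTime (U : EuclideanSpace ℝ (Fin N) → ℝ) (ε : ℝ)
    (x v : EuclideanSpace ℝ (Fin N)) (ω : ℕ × Fin N → ℝ) (n : ℕ) : ℝ≥0∞ :=
  waitTime U ε (skeleton U ε x v ω n).2.1 (skeleton U ε x v ω n).2.2 fun j => ω (n, j)

/-- The time left, at the start of the `n`-th flight, until `T` or the exit of the flight
from `B`. -/
def horizon (U : EuclideanSpace ℝ (Fin N) → ℝ) (ε : ℝ) (B : Set (EuclideanSpace ℝ (Fin N)))
    (T : ℝ) (x v : EuclideanSpace ℝ (Fin N)) (ω : ℕ × Fin N → ℝ) (n : ℕ) : ℝ≥0∞ :=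
  min (exitRay B (skeleton U ε x v ω n).2.1 (skeleton U ε x v ω n).2.2)
    (ENNReal.ofReal T - (skeleton U ε x v ω n).1)

/-- The `n`-th event happens before `T` and before the exit from `B`. -/
def Active (U : EuclideanSpace ℝ (Fin N) → ℝ) (ε : ℝ) (B : Set (EuclideanSpace ℝ (Fin N)))
    (T : ℝ) (x v : EuclideanSpace ℝ (Fin N)) (ω : ℕ × Fin N → ℝ) : ℕ → Prop
  | 0 => True
  | n + 1 => Active U ε B T x v ω n ∧ flightTime U ε x v ω n ≤ horizon U ε B T x v ω n

/-- The length of the part of the `n`-th flight before `T` and before the exit from `B`. -/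
def activeLen (U : EuclideanSpace ℝ (Fin N) → ℝ) (ε : ℝ) (B : Set (EuclideanSpace ℝ (Fin N)))
    (T : ℝ) (x v : EuclideanSpace ℝ (Fin N)) (ω : ℕ × Fin N → ℝ) (n : ℕ) : ℝ :=
  (min (flightTime U ε x v ω n) (horizon U ε B T x v ω n)).toReal

/-- The `n`-th flight ends with the ringing of coordinate `i`. -/
def Rings (U : EuclideanSpace ℝ (Fin N) → ℝ) (ε : ℝ)
    (x v : EuclideanSpace ℝ (Fin N)) (i : Fin N) (ω : ℕ × Fin N → ℝ) (n : ℕ) : Prop :=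
  ringTime U ε i (skeleton U ε x v ω n).2.1 (skeleton U ε x v ω n).2.2 (ω (n, i))
    = flightTime U ε x v ω n

section Measurability

variable {U : EuclideanSpace ℝ (Fin N) → ℝ} {ε : ℝ}

theorem continuous_drive_uncurry (hU : ∀ i, Continuous (pd U i)) (i : Fin N) :
    Continuous fun q : (EuclideanSpace ℝ (Fin N) × EuclideanSpace ℝ (Fin N)) × ℝ =>
      drive U i q.1.1 q.1.2 q.2 := by
  have := hU i
  unfold drive
  fun_prop

theorem continuous_drive (hU : ∀ i, Continuous (pd U i)) (i : Fin N)
    (x v : EuclideanSpace ℝ (Fin N)) : Continuous (drive U i x v) :=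
  (continuous_drive_uncurry hU i).comp (Continuous.prodMk_right (x, v))

theorem continuous_rate (hU : ∀ i, Continuous (pd U i)) (i : Fin N)
    (x v : EuclideanSpace ℝ (Fin N)) : Continuous fun s => ε⁻¹ * max (drive U i x v s) 0 := by
  have := continuous_drive hU i x v
  fun_prop

theorem rate_nonneg (hε : 0 < ε) (i : Fin N)
    (x v : EuclideanSpace ℝ (Fin N)) (s : ℝ) : 0 ≤ ε⁻¹ * max (drive U i x v s) 0 := by
  positivity

theorem measurable_ringTime (hU : ∀ i, Continuous (pd U i)) (hε : 0 < ε) (i : Fin N) :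
    Measurable fun q : (EuclideanSpace ℝ (Fin N) × EuclideanSpace ℝ (Fin N)) × ℝ =>
      ringTime U ε i q.1.1 q.1.2 q.2 := by
  refine measurable_hitTime
    (lam := fun (q : (EuclideanSpace ℝ (Fin N) × EuclideanSpace ℝ (Fin N)) × ℝ) s =>
      ε⁻¹ * max (drive U i q.1.1 q.1.2 s) 0) (e := fun q => q.2)
    (fun q => continuous_rate hU i _ _) (fun q s => rate_nonneg hε i _ _ s) (fun t => ?_)
    measurable_snd
  have hc := continuous_drive_uncurry hU i
  have : Continuous fun q : EuclideanSpace ℝ (Fin N) × EuclideanSpace ℝ (Fin N) =>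
      ∫ s in (0 : ℝ)..t, ε⁻¹ * max (drive U i q.1 q.2 s) 0 := by
    apply intervalIntegral.continuous_parametric_intervalIntegral_of_continuous'
    simp only [Function.uncurry_def]
    fun_prop
  exact this.measurable.comp measurable_fst

theorem measurable_exitRay {B : Set (EuclideanSpace ℝ (Fin N))} (hB : IsClosed B) :
    Measurable fun q : EuclideanSpace ℝ (Fin N) × EuclideanSpace ℝ (Fin N) =>
      exitRay B q.1 q.2 := by
  refine measurable_of_Iio fun c => IsOpen.measurableSet ?_
  -- For closed B an exit before c is witnessed at one fixed time s, and leaving at that s is an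
  -- open condition on the starting data.
  have : (fun q : EuclideanSpace ℝ (Fin N) × EuclideanSpace ℝ (Fin N) => exitRay B q.1 q.2) ⁻¹'
      Iio c = ⋃ s : ℝ, ⋃ _ : 0 ≤ s ∧ ENNReal.ofReal s < c, {q | q.1 + s • q.2 ∈ Bᶜ} := by
    ext q
    simp only [exitRay, mem_preimage, mem_Iio, iInf_lt_iff, mem_iUnion, mem_compl_iff,
      mem_ofPred_eq, exists_prop]
    exact ⟨fun ⟨s, h1, h2⟩ => ⟨s, ⟨h1.1, h2⟩, h1.2⟩, fun ⟨s, h1, h2⟩ => ⟨s, ⟨h1.1, h2⟩, h1.2⟩⟩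
  rw [this]
  refine isOpen_iUnion fun s => isOpen_iUnion fun _ => hB.isOpen_compl.preimage ?_
  fun_prop

theorem measurable_skeleton (hU : ∀ i, Continuous (pd U i)) (hε : 0 < ε)
    (x v : EuclideanSpace ℝ (Fin N)) (n : ℕ) :
    Measurable fun ω => skeleton U ε x v ω n := by
  induction n with
  | zero => exact measurable_const
  | succ n ih =>
    have hX : Measurable fun ω => (skeleton U ε x v ω n).2.1 := ih.snd.fst
    have hV : Measurable fun ω => (skeleton U ε x v ω n).2.2 := ih.snd.snd
    have hr : ∀ i, Measurable fun ω => ringTime U ε i (skeleton U ε x v ω n).2.1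
        (skeleton U ε x v ω n).2.2 (ω (n, i)) := fun i =>
      (measurable_ringTime hU hε i).comp ((hX.prodMk hV).prodMk (measurable_pi_apply _))
    have hw : Measurable fun ω => waitTime U ε (skeleton U ε x v ω n).2.1
        (skeleton U ε x v ω n).2.2 fun i => ω (n, i) := Measurable.iInf hr
    refine (ih.fst.add hw).prodMk ((hX.add (hw.ennreal_toReal.smul hV)).prodMk ?_)
    refine (WithLp.measurable_toLp 2 _).comp (measurable_pi_lambda _ fun i => ?_)
    have hVi : Measurable fun ω => (skeleton U ε x v ω n).2.2 i :=
      (EuclideanSpace.proj (𝕜 := ℝ) i).measurable.comp hV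
    exact Measurable.ite (measurableSet_eq_fun (hr i) hw) hVi.neg hVi

theorem measurable_ringTime_path (hU : ∀ i, Continuous (pd U i)) (hε : 0 < ε)
    (x v : EuclideanSpace ℝ (Fin N)) (i : Fin N) (n : ℕ) :
    Measurable fun ω => ringTime U ε i (skeleton U ε x v ω n).2.1
        (skeleton U ε x v ω n).2.2 (ω (n, i)) :=
  (measurable_ringTime hU hε i).comp
    (((measurable_skeleton hU hε x v n).snd.fst.prodMk
      (measurable_skeleton hU hε x v n).snd.snd).prodMk (measurable_pi_apply _))

theorem measurable_flightTime (hU : ∀ i, Continuous (pd U i)) (hε : 0 < ε)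
    (x v : EuclideanSpace ℝ (Fin N)) (n : ℕ) :
    Measurable fun ω => flightTime U ε x v ω n :=
  Measurable.iInf fun i => measurable_ringTime_path hU hε x v i n

theorem measurable_horizon (hU : ∀ i, Continuous (pd U i)) (hε : 0 < ε)
    {B : Set (EuclideanSpace ℝ (Fin N))} (hB : IsClosed B) (T : ℝ)
    (x v : EuclideanSpace ℝ (Fin N)) (n : ℕ) :
    Measurable fun ω => horizon U ε B T x v ω n :=
  have h := measurable_skeleton hU hε x v n
  ((measurable_exitRay hB).comp (h.snd.fst.prodMk h.snd.snd)).min (measurable_const.sub h.fst)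

theorem measurableSet_active (hU : ∀ i, Continuous (pd U i)) (hε : 0 < ε)
    {B : Set (EuclideanSpace ℝ (Fin N))} (hB : IsClosed B) (T : ℝ)
    (x v : EuclideanSpace ℝ (Fin N)) (n : ℕ) :
    MeasurableSet {ω | Active U ε B T x v ω n} := by
  induction n with
  | zero => exact MeasurableSet.univ
  | succ n ih =>
    exact ih.inter (measurableSet_le (measurable_flightTime hU hε x v n)
      (measurable_horizon hU hε hB T x v n))

theorem measurable_activeLen (hU : ∀ i, Continuous (pd U i)) (hε : 0 < ε)
    {B : Set (EuclideanSpace ℝ (Fin N))} (hB : IsClosed B) (T : ℝ)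
    (x v : EuclideanSpace ℝ (Fin N)) (n : ℕ) :
    Measurable fun ω => activeLen U ε B T x v ω n :=
  ((measurable_flightTime hU hε x v n).min
    (measurable_horizon hU hε hB T x v n)).ennreal_toReal

theorem measurableSet_rings (hU : ∀ i, Continuous (pd U i)) (hε : 0 < ε)
    (x v : EuclideanSpace ℝ (Fin N)) (i : Fin N) (n : ℕ) :
    MeasurableSet {ω | Rings U ε x v i ω n} :=
  measurableSet_eq_fun (measurable_ringTime_path hU hε x v i n)
    (measurable_flightTime hU hε x v n)

theorem measurable_drive_path (hU : ∀ i, Continuous (pd U i)) (hε : 0 < ε)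
    (x v : EuclideanSpace ℝ (Fin N)) (i : Fin N) (n : ℕ) :
    Measurable fun q : (ℕ × Fin N → ℝ) × ℝ =>
      drive U i (skeleton U ε x v q.1 n).2.1 (skeleton U ε x v q.1 n).2.2 q.2 := by
  have h : Measurable fun q : (ℕ × Fin N → ℝ) × ℝ => skeleton U ε x v q.1 n :=
    (measurable_skeleton hU hε x v n).comp measurable_fst
  exact (continuous_drive_uncurry hU i).measurable.comp
    ((h.snd.fst.prodMk h.snd.snd).prodMk measurable_snd)

theorem measurable_lintegral_activeLen (hU : ∀ i, Continuous (pd U i)) (hε : 0 < ε)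
    {B : Set (EuclideanSpace ℝ (Fin N))} (hB : IsClosed B) (T : ℝ)
    (x v : EuclideanSpace ℝ (Fin N)) (n : ℕ) {f : (ℕ × Fin N → ℝ) → ℝ → ℝ≥0∞}
    (hf : Measurable (Function.uncurry f)) :
    Measurable fun ω => ∫⁻ s in Ioo 0 (activeLen U ε B T x v ω n), f ω s := by
  have : (fun ω => ∫⁻ s in Ioo 0 (activeLen U ε B T x v ω n), f ω s)
      = fun ω => ∫⁻ s, {q : (ℕ × Fin N → ℝ) × ℝ | 0 < q.2 ∧
          q.2 < activeLen U ε B T x v q.1 n}.indicator (Function.uncurry f) (ω, s) := by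
    ext ω
    rw [← lintegral_indicator measurableSet_Ioo]
    rfl
  rw [this]
  refine Measurable.lintegral_prod_right' (hf.indicator ?_)
  exact (measurableSet_lt measurable_const measurable_snd).inter
    (measurableSet_lt measurable_snd
      ((measurable_activeLen hU hε hB T x v n).comp measurable_fst))

end Measurability

/-! ### Refreshing one independent coordinate. -/

section Resampling

/-- Resampling one coordinate of a product measure. -/
theorem lintegral_infinitePi_update {ι : Type*} [DecidableEq ι] {X : ι → Type*}
    [∀ i, MeasurableSpace (X i)] (μ : (i : ι) → Measure (X i)) [∀ i, IsProbabilityMeasure (μ i)]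
    (k : ι) {F : (∀ i, X i) → ℝ≥0∞} (hF : Measurable F) :
    ∫⁻ ω, F ω ∂(Measure.infinitePi μ)
      = ∫⁻ ω, ∫⁻ u, F (Function.update ω k u) ∂(μ k) ∂(Measure.infinitePi μ) := by
  have hup : Measurable fun p : (∀ i, X i) × X k => Function.update p.1 k p.2 := by
    refine measurable_pi_lambda _ fun j => ?_
    by_cases h : j = k
    · subst h; simpa using measurable_snd
    · simp only [Function.update_of_ne h]
      exact (measurable_pi_apply j).comp measurable_fst
  -- Overwriting coordinate k by an independent draw preserves the product measure; it suffices to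
  -- check this on finite boxes.
  have hmap : ((Measure.infinitePi μ).prod (μ k)).map
      (fun p : (∀ i, X i) × X k => Function.update p.1 k p.2) = Measure.infinitePi μ := by
    refine Measure.eq_infinitePi μ fun s t ht => ?_
    have hmeas : MeasurableSet (Set.pi (s : Set ι) t) :=
      MeasurableSet.pi s.countable_toSet fun i _ => ht i
    rw [Measure.map_apply hup hmeas]
    have hpre : (fun p : (∀ i, X i) × X k => Function.update p.1 k p.2) ⁻¹' (Set.pi (s : Set ι) t)
        = (Set.pi ((s.erase k : Finset ι) : Set ι) t) ×ˢ (if k ∈ s then t k else univ) := by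
      ext p
      simp only [mem_preimage, Set.mem_pi, Finset.mem_coe, mem_prod, Finset.mem_erase]
      constructor
      · intro h
        refine ⟨fun i hi => ?_, ?_⟩
        · simpa [Function.update_of_ne hi.1] using h i hi.2
        · split_ifs with hk
          · simpa using h k hk
          · trivial
      · rintro ⟨h1, h2⟩ i hi
        by_cases hik : i = k
        · subst hik; simpa [hi] using h2
        · simpa [Function.update_of_ne hik] using h1 i ⟨hik, hi⟩
    rw [hpre, Measure.prod_prod, Measure.infinitePi_pi μ fun i _ => ht i]
    split_ifs with hk
    · rw [mul_comm, Finset.mul_prod_erase s (fun i => μ i (t i)) hk]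
    · rw [measure_univ, mul_one, Finset.erase_eq_of_notMem hk]
  conv_lhs => rw [← hmap]
  rw [lintegral_map hF hup, lintegral_prod (fun p => F (Function.update p.1 k p.2))
    (hF.comp hup).aemeasurable]

end Resampling

/-! ### The compensator identity for one flight. -/

section Compensator

variable {U : EuclideanSpace ℝ (Fin N) → ℝ} {ε : ℝ}

/-- The first n events read only clock levels of index below n, so the levels of flight m ≥ n are
still fresh at the start of flight n. -/
theorem skeleton_update (x v : EuclideanSpace ℝ (Fin N)) (ω : ℕ × Fin N → ℝ) {n m : ℕ}
    (h : n ≤ m) (i : Fin N) (u : ℝ) :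
    skeleton U ε x v (Function.update ω (m, i) u) n = skeleton U ε x v ω n := by
  induction n with
  | zero => rfl
  | succ n ih =>
    have hne : ∀ j, Function.update ω (m, i) u (n, j) = ω (n, j) := fun j =>
      Function.update_of_ne (by simp; omega) _ _
    simp only [skeleton, ih (by omega), hne]

theorem horizon_update (B : Set (EuclideanSpace ℝ (Fin N))) (T : ℝ)
    (x v : EuclideanSpace ℝ (Fin N)) (ω : ℕ × Fin N → ℝ) {n m : ℕ}
    (h : n ≤ m) (i : Fin N) (u : ℝ) :
    horizon U ε B T x v (Function.update ω (m, i) u) n = horizon U ε B T x v ω n := by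
  simp only [horizon, skeleton_update x v ω h]

theorem flightTime_update (x v : EuclideanSpace ℝ (Fin N)) (ω : ℕ × Fin N → ℝ) {n m : ℕ}
    (h : n < m) (i : Fin N) (u : ℝ) :
    flightTime U ε x v (Function.update ω (m, i) u) n = flightTime U ε x v ω n := by
  have hne : ∀ j, Function.update ω (m, i) u (n, j) = ω (n, j) := fun j =>
    Function.update_of_ne (by simp; omega) _ _
  simp only [flightTime, skeleton_update x v ω h.le, hne]

theorem active_update (B : Set (EuclideanSpace ℝ (Fin N))) (T : ℝ)
    (x v : EuclideanSpace ℝ (Fin N)) (ω : ℕ × Fin N → ℝ) {n m : ℕ}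
    (h : n ≤ m) (i : Fin N) (u : ℝ) :
    Active U ε B T x v (Function.update ω (m, i) u) n ↔ Active U ε B T x v ω n := by
  induction n with
  | zero => rfl
  | succ n ih =>
    simp only [Active, ih (by omega), flightTime_update x v ω (show n < m by omega),
      horizon_update B T x v ω (show n ≤ m by omega)]

/-- Isolates the clock of coordinate i: the minimum over the other clocks is frozen and acts as a
deterministic deadline when clock i is resampled. -/
theorem flightTime_update_self (x v : EuclideanSpace ℝ (Fin N)) (ω : ℕ × Fin N → ℝ) (n : ℕ)
    (i : Fin N) (u : ℝ) :
    flightTime U ε x v (Function.update ω (n, i) u) n =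
      min (ringTime U ε i (skeleton U ε x v ω n).2.1 (skeleton U ε x v ω n).2.2 u)
        (⨅ (j : Fin N) (_ : j ≠ i), ringTime U ε j (skeleton U ε x v ω n).2.1
          (skeleton U ε x v ω n).2.2 (ω (n, j))) := by
  simp only [flightTime, skeleton_update x v ω le_rfl, waitTime]
  rw [iInf_split_single (fun j => ringTime U ε j (skeleton U ε x v ω n).2.1
    (skeleton U ε x v ω n).2.2 (Function.update ω (n, i) u (n, j))) i, Function.update_self]
  congr 1
  refine iInf_congr fun j => iInf_congr fun hj => ?_
  rw [Function.update_of_ne (by simpa using hj)]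

theorem horizon_ne_top (B : Set (EuclideanSpace ℝ (Fin N))) (T : ℝ)
    (x v : EuclideanSpace ℝ (Fin N)) (ω : ℕ × Fin N → ℝ) (n : ℕ) :
    horizon U ε B T x v ω n ≠ ∞ :=
  ((min_le_right _ _).trans_lt (tsub_le_self.trans_lt ENNReal.ofReal_lt_top)).ne

instance isProbabilityMeasure_expMeasure_one : IsProbabilityMeasure (expMeasure 1) :=
  isProbabilityMeasure_expMeasure one_pos

instance isProbabilityMeasure_clockMeasure : IsProbabilityMeasure (clockMeasure N) := by
  unfold clockMeasure; infer_instance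

/-- The expected sum of `g` over the ringings of coordinate `i` at the end of the `n`-th flight
equals the expected integral of `g` against the switching rate. -/
theorem lintegral_rings (hU : ∀ i, Continuous (pd U i)) (hε : 0 < ε)
    {B : Set (EuclideanSpace ℝ (Fin N))} (hB : IsClosed B) (T : ℝ)
    (x v : EuclideanSpace ℝ (Fin N)) (i : Fin N) (n : ℕ) {g : ℝ → ℝ≥0∞} (hg : Measurable g) :
    ∫⁻ ω, {ω | Active U ε B T x v ω (n + 1) ∧ Rings U ε x v i ω n}.indicator
        (fun ω => g (drive U i (skeleton U ε x v ω n).2.1 (skeleton U ε x v ω n).2.2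
          (flightTime U ε x v ω n).toReal)) ω ∂(clockMeasure N)
      = ∫⁻ ω, {ω | Active U ε B T x v ω n}.indicator
        (fun ω => ∫⁻ s in Ioo 0 (activeLen U ε B T x v ω n),
          ENNReal.ofReal (ε⁻¹ * max (drive U i (skeleton U ε x v ω n).2.1
            (skeleton U ε x v ω n).2.2 s) 0) *
          g (drive U i (skeleton U ε x v ω n).2.1 (skeleton U ε x v ω n).2.2 s)) ω
            ∂(clockMeasure N) := by
  have hdrive := measurable_drive_path hU hε x v i n
  have hm1 : Measurable ({ω | Active U ε B T x v ω (n + 1) ∧ Rings U ε x v i ω n}.indicator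
        (fun ω => g (drive U i (skeleton U ε x v ω n).2.1 (skeleton U ε x v ω n).2.2
          (flightTime U ε x v ω n).toReal))) := by
    refine Measurable.indicator (hg.comp ?_) ((measurableSet_active hU hε hB T x v (n + 1)).inter
      (measurableSet_rings hU hε x v i n))
    exact hdrive.comp (measurable_id.prodMk (measurable_flightTime hU hε x v n).ennreal_toReal)
  have hm2 : Measurable ({ω | Active U ε B T x v ω n}.indicator
        (fun ω => ∫⁻ s in Ioo 0 (activeLen U ε B T x v ω n),
          ENNReal.ofReal (ε⁻¹ * max (drive U i (skeleton U ε x v ω n).2.1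
            (skeleton U ε x v ω n).2.2 s) 0) *
          g (drive U i (skeleton U ε x v ω n).2.1 (skeleton U ε x v ω n).2.2 s))) := by
    refine Measurable.indicator (measurable_lintegral_activeLen hU hε hB T x v n ?_)
      (measurableSet_active hU hε hB T x v n)
    exact ((hdrive.max measurable_const).const_mul _).ennreal_ofReal.mul (hg.comp hdrive)
  unfold clockMeasure
  -- Conditionally on everything except clock (n, i), the claim is the one-clock identity with
  -- deadline `min W' D`.
  rw [lintegral_infinitePi_update _ (n, i) hm1, lintegral_infinitePi_update _ (n, i) hm2]
  refine lintegral_congr fun ω => ?_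
  by_cases hact : Active U ε B T x v ω n
  swap
  · have h1 : ∀ u, ¬ Active U ε B T x v (Function.update ω (n, i) u) n := fun u => by
      rwa [active_update B T x v ω le_rfl]
    simp [indicator, h1, Active]
  set X := (skeleton U ε x v ω n).2.1
  set V := (skeleton U ε x v ω n).2.2
  set lam : ℝ → ℝ := fun s => ε⁻¹ * max (drive U i X V s) 0
  set W' := ⨅ (j : Fin N) (_ : j ≠ i), ringTime U ε j X V (ω (n, j))
  set D := horizon U ε B T x v ω n with hD
  have hDtop : D ≠ ∞ := horizon_ne_top B T x v ω n
  have hWD : min W' D ≠ ∞ := ((min_le_right _ _).trans_lt hDtop.lt_top).ne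
  have hring : ∀ u, ringTime U ε i X V u = hitTime lam u := fun u => rfl
  have hfl : ∀ u, flightTime U ε x v (Function.update ω (n, i) u) n = min (hitTime lam u) W' :=
    fun u => flightTime_update_self x v ω n i u
  have key := lintegral_hitTime (continuous_rate hU i X V) (rate_nonneg hε i X V)
    (fun s => g (drive U i X V s)) (d := (min W' D).toReal)
    (measurable_hitTime (lam := fun _ : ℝ => lam) (fun _ => continuous_rate hU i X V)
      (fun _ => rate_nonneg hε i X V) (fun _ => measurable_const) measurable_id)
    (hg.comp (continuous_drive hU i X V).measurable) ENNReal.toReal_nonneg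
  rw [ENNReal.ofReal_toReal hWD] at key
  -- Coordinate i ends an active flight exactly when its clock rings by the deadline; the weak
  -- inequality includes ties.
  have hL : ∀ u, indicator {u | hitTime lam u ≤ min W' D}
      (fun u => g (drive U i X V (hitTime lam u).toReal)) u
      = {ω | Active U ε B T x v ω (n + 1) ∧ Rings U ε x v i ω n}.indicator
        (fun ω => g (drive U i (skeleton U ε x v ω n).2.1 (skeleton U ε x v ω n).2.2
          (flightTime U ε x v ω n).toReal)) (Function.update ω (n, i) u) := by
    intro u
    by_cases hu : hitTime lam u ≤ min W' D
    · have h2 : min (hitTime lam u) W' = hitTime lam u := min_eq_left (hu.trans (min_le_left _ _))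
      rw [indicator_of_mem (show u ∈ {u | hitTime lam u ≤ min W' D} from hu), indicator_of_mem]
      · simp only [skeleton_update x v ω le_rfl, hfl, h2]; rfl
      · refine ⟨⟨(active_update B T x v ω le_rfl i u).2 hact, ?_⟩, ?_⟩
        · rw [hfl, h2, horizon_update B T x v ω le_rfl]
          exact hu.trans (min_le_right _ _)
        · unfold Rings
          rw [hfl, h2, skeleton_update x v ω le_rfl, Function.update_self]; rfl
    · rw [indicator_of_notMem (show u ∉ {u | hitTime lam u ≤ min W' D} from hu),
        indicator_of_notMem]
      rintro ⟨⟨-, h1⟩, h2⟩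
      unfold Rings at h2
      rw [hfl, horizon_update B T x v ω le_rfl] at h1
      rw [hfl, skeleton_update x v ω le_rfl, Function.update_self] at h2
      change hitTime lam u = _ at h2
      refine hu (le_min ?_ ?_)
      · rw [h2]; exact min_le_right _ _
      · rw [h2]; exact h1
  have hR : ∀ u, (∫⁻ s in Ioo 0 (min (hitTime lam u) (min W' D)).toReal,
        ENNReal.ofReal (lam s) * g (drive U i X V s))
      = {ω | Active U ε B T x v ω n}.indicator
        (fun ω => ∫⁻ s in Ioo 0 (activeLen U ε B T x v ω n),
          ENNReal.ofReal (ε⁻¹ * max (drive U i (skeleton U ε x v ω n).2.1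
            (skeleton U ε x v ω n).2.2 s) 0) *
          g (drive U i (skeleton U ε x v ω n).2.1 (skeleton U ε x v ω n).2.2 s))
            (Function.update ω (n, i) u) := by
    intro u
    rw [indicator_of_mem (show Function.update ω (n, i) u ∈ {ω | Active U ε B T x v ω n} from
      (active_update B T x v ω le_rfl i u).2 hact)]
    simp only [activeLen, skeleton_update x v ω le_rfl, hfl, horizon_update B T x v ω le_rfl]
    rw [min_assoc]
  simp_rw [← hL, ← hR]
  exact key

end Compensator

/-! ### Growth of the signed derivative along one flight. -/

/-- Vectors with coordinates `±1`. -/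
def IsSign (v : EuclideanSpace ℝ (Fin N)) : Prop := ∀ j, v j = 1 ∨ v j = -1

/-- Bounds on `∂ᵢU` and on its slope along flights in the region `B`; where `∂ᵢU` is small, the
slope of the signed derivative is bounded below. -/
structure Controlled (U : EuclideanSpace ℝ (Fin N) → ℝ) (i : Fin N)
    (B : Set (EuclideanSpace ℝ (Fin N))) (K M η δ : ℝ) : Prop where
  isClosed : IsClosed B
  K_pos : 0 < K
  M_nonneg : 0 ≤ M
  η_pos : 0 < η
  δ_pos : 0 < δ
  abs_le : ∀ y ∈ B, |pd U i y| ≤ M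
  slope : ∀ y ∈ B, ∀ v, IsSign v → ∃ d, HasDerivAt (fun s : ℝ => v i * pd U i (y + s • v)) d 0 ∧
    d ≤ K ∧ (|pd U i y| ≤ η → δ ≤ d)

section Flight

variable {U : EuclideanSpace ℝ (Fin N) → ℝ} {i : Fin N} {B : Set (EuclideanSpace ℝ (Fin N))}
  {K M η δ : ℝ} {x v : EuclideanSpace ℝ (Fin N)}

theorem abs_drive (hv : IsSign v) (s : ℝ) : |drive U i x v s| = |pd U i (x + s • v)| := by
  unfold drive
  rcases hv i with h | h <;> simp [h]

theorem Controlled.drive_slope (hC : Controlled U i B K M η δ) (hv : IsSign v) {s : ℝ}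
    (hs : x + s • v ∈ B) :
    ∃ d, HasDerivAt (drive U i x v) d s ∧ d ≤ K ∧ (|drive U i x v s| ≤ η → δ ≤ d) := by
  obtain ⟨d, hd, h1, h2⟩ := hC.slope _ hs v hv
  refine ⟨d, ?_, h1, fun h => h2 (by rwa [← abs_drive hv])⟩
  have h3 : HasDerivAt (fun r : ℝ => v i * pd U i (x + s • v + r • v)) d (s - s) := by
    rwa [sub_self]
  have h4 := h3.comp_sub_const s s
  refine h4.congr_of_eventuallyEq (Eventually.of_forall fun r => ?_)
  simp only [drive]
  congr 2
  rw [sub_smul]; abel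

/-- Squaring smooths the kink of the positive part at 0, so the square can be differentiated along a
flight without a case split on the sign. -/
theorem hasDerivAt_max_sq (y : ℝ) : HasDerivAt (fun y : ℝ => (max y 0) ^ 2) (2 * max y 0) y := by
  rcases lt_trichotomy y 0 with h | h | h
  · rw [max_eq_right h.le, mul_zero]
    refine (hasDerivAt_const y (0 : ℝ)).congr_of_eventuallyEq ?_
    filter_upwards [gt_mem_nhds h] with z hz
    simp [max_eq_right (le_of_lt hz)]
  · subst h
    rw [max_self, mul_zero, hasDerivAt_iff_isLittleO]
    simp only [max_self, sub_zero, smul_zero]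
    have h2 : (fun y : ℝ => (max y 0) ^ 2 - 0 ^ 2) =O[𝓝 0] fun y : ℝ => y ^ 2 := by
      refine Asymptotics.IsBigO.of_bound 1 (Eventually.of_forall fun y => ?_)
      rw [one_mul, Real.norm_eq_abs, Real.norm_eq_abs, zero_pow two_ne_zero, sub_zero, abs_sq,
        abs_sq]
      rcases le_total y 0 with h | h
      · rw [max_eq_right h]; nlinarith [sq_nonneg y]
      · rw [max_eq_left h]
    exact h2.trans_isLittleO (Asymptotics.isLittleO_pow_id one_lt_two)
  · rw [max_eq_left h.le]
    have : HasDerivAt (fun y : ℝ => y ^ 2) (2 * y) y := by simpa using hasDerivAt_pow 2 y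
    refine this.congr_of_eventuallyEq ?_
    filter_upwards [lt_mem_nhds h] with z hz
    simp [max_eq_left (le_of_lt hz)]

variable {L : ℝ}

theorem Controlled.drive_le (hC : Controlled U i B K M η δ) (hv : IsSign v)
    (hB : ∀ s ∈ Icc 0 L, x + s • v ∈ B) {s : ℝ} (hs : s ∈ Icc 0 L) :
    drive U i x v s ≤ drive U i x v 0 + K * s := by
  choose! d hd using fun s (hs : s ∈ Icc 0 L) => hC.drive_slope (x := x) hv (hB s hs)
  refine image_le_of_deriv_right_le_deriv_boundary (f := drive U i x v) (f' := d)
    (B := fun s => drive U i x v 0 + K * s) (B' := fun _ => K) (a := 0) (b := L)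
    (fun s hs => (hd s hs).1.continuousAt.continuousWithinAt)
    (fun s hs => (hd s (Ico_subset_Icc_self hs)).1.hasDerivWithinAt) (by simp) (by fun_prop)
    (fun s _ => ?_) (fun s hs => (hd s (Ico_subset_Icc_self hs)).2.1) hs
  simpa using (((hasDerivAt_id s).const_mul K).const_add (drive U i x v 0)).hasDerivWithinAt

/-- The derivative of z₊² is 2 z₊ z', at most 2K z₊. -/
theorem Controlled.drive_sq_le (hC : Controlled U i B K M η δ) (hU : ∀ i, Continuous (pd U i))
    (hv : IsSign v) (hB : ∀ s ∈ Icc 0 L, x + s • v ∈ B) {s : ℝ} (hs : s ∈ Icc 0 L) :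
    (max (drive U i x v s) 0) ^ 2 ≤ (max (drive U i x v 0) 0) ^ 2
      + 2 * K * ∫ r in (0 : ℝ)..s, max (drive U i x v r) 0 := by
  choose! d hd using fun s (hs : s ∈ Icc 0 L) => hC.drive_slope (x := x) hv (hB s hs)
  have hcont : Continuous fun r => max (drive U i x v r) 0 :=
    (continuous_drive hU i x v).max continuous_const
  refine image_le_of_deriv_right_le_deriv_boundary
    (f := fun s => (max (drive U i x v s) 0) ^ 2)
    (f' := fun s => 2 * max (drive U i x v s) 0 * d s)
    (B := fun s => (max (drive U i x v 0) 0) ^ 2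
      + 2 * K * ∫ r in (0 : ℝ)..s, max (drive U i x v r) 0)
    (B' := fun s => 2 * K * max (drive U i x v s) 0) (a := 0) (b := L)
    (hcont.pow 2).continuousOn
    (fun s hs => ((hasDerivAt_max_sq _).comp s
      (hd s (Ico_subset_Icc_self hs)).1).hasDerivWithinAt) (by simp)
    (((continuous_primitive hcont).const_mul _).const_add _).continuousOn
    (fun s _ => (((hasDerivAt_primitive hcont s).const_mul (2 * K)).const_add
      _).hasDerivWithinAt) (fun s hs => ?_) hs
  have h1 := (hd s (Ico_subset_Icc_self hs)).2.1
  have h2 : 0 ≤ max (drive U i x v s) 0 := le_max_right _ _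
  nlinarith

/-- The level -w is a barrier: since w ≤ η, the slope at a contact is at least δ > 0, which forbids
a downward crossing. -/
theorem Controlled.neg_le_drive (hC : Controlled U i B K M η δ) (hv : IsSign v)
    (hB : ∀ s ∈ Icc 0 L, x + s • v ∈ B) {w : ℝ} (hw0 : 0 ≤ w) (hw : w ≤ η)
    (hz : -w ≤ drive U i x v 0) {s : ℝ} (hs : s ∈ Icc 0 L) :
    -w ≤ drive U i x v s := by
  choose! d hd using fun s (hs : s ∈ Icc 0 L) => hC.drive_slope (x := x) hv (hB s hs)
  have := image_le_of_deriv_right_lt_deriv_boundary' (f := fun s => -drive U i x v s)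
    (f' := fun s => -d s) (B := fun _ => w) (B' := fun _ => 0) (a := 0) (b := L)
    (fun s hs => (hd s hs).1.neg.continuousAt.continuousWithinAt)
    (fun s hs => (hd s (Ico_subset_Icc_self hs)).1.neg.hasDerivWithinAt) (by linarith)
    continuousOn_const (fun s _ => hasDerivWithinAt_const _ _ _)
    (fun s hs h => ?_) hs
  · linarith
  · have h1 := (hd s (Ico_subset_Icc_self hs)).2.2 (by
      rw [← abs_neg, h, abs_of_nonneg hw0]; exact hw)
    linarith [hC.δ_pos]

theorem Controlled.le_drive (hC : Controlled U i B K M η δ) (hv : IsSign v)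
    (hB : ∀ s ∈ Icc 0 L, x + s • v ∈ B) (hz : ∀ s ∈ Icc 0 L, |drive U i x v s| ≤ η)
    {s : ℝ} (hs : s ∈ Icc 0 L) :
    drive U i x v 0 + δ * s ≤ drive U i x v s := by
  choose! d hd using fun s (hs : s ∈ Icc 0 L) => hC.drive_slope (x := x) hv (hB s hs)
  have := image_le_of_deriv_right_le_deriv_boundary (f := fun s => -drive U i x v s)
    (f' := fun s => -d s)
    (B := fun s => -drive U i x v 0 - δ * s) (B' := fun _ => -δ) (a := 0) (b := L)
    (fun s hs => (hd s hs).1.neg.continuousAt.continuousWithinAt)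
    (fun s hs => (hd s (Ico_subset_Icc_self hs)).1.neg.hasDerivWithinAt) (by simp) (by fun_prop)
    (fun s _ => ?_) (fun s hs => neg_le_neg
      ((hd s (Ico_subset_Icc_self hs)).2.2 (hz s (Ico_subset_Icc_self hs)))) hs
  · linarith
  · simpa using (((hasDerivAt_id s).const_mul δ).const_sub (-drive U i x v 0)).hasDerivWithinAt

theorem mem_of_le_exitRay (hB : IsClosed B) (hx : x ∈ B) {s : ℝ} (hs : 0 ≤ s)
    (h : ENNReal.ofReal s ≤ exitRay B x v) : x + s • v ∈ B := by
  have hlt : ∀ r, 0 ≤ r → r < s → x + r • v ∈ B := by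
    intro r hr hrs
    by_contra hn
    have : exitRay B x v ≤ ENNReal.ofReal r :=
      iInf₂_le (f := fun r _ => ENNReal.ofReal r) r ⟨hr, hn⟩
    exact absurd (h.trans this) (not_le.2 ((ENNReal.ofReal_lt_ofReal_iff_of_nonneg hr).2 hrs))
  rcases hs.eq_or_lt with rfl | hpos
  · simpa using hx
  · have hcl : s ∈ closure (Ico 0 s) := by
      rw [closure_Ico hpos.ne]; exact right_mem_Icc.2 hs
    have hcont : Continuous fun r : ℝ => x + r • v := by fun_prop
    have := hcont.continuousAt.continuousWithinAt.mem_closure (s := Ico 0 s) (x := s) (t := B)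
      hcl (fun r hr => hlt r hr.1 hr.2)
    rwa [hB.closure_eq] at this

end Flight

/-! ### Telescoping over the events of a path. -/

section Path

variable {U : EuclideanSpace ℝ (Fin N) → ℝ} {ε : ℝ} {i : Fin N}
  {B : Set (EuclideanSpace ℝ (Fin N))} {T : ℝ} {K M η δ : ℝ}
  {x v : EuclideanSpace ℝ (Fin N)} {ω : ℕ × Fin N → ℝ}

/-- The signed partial derivative along the `n`-th flight. -/
def pathDrive (U : EuclideanSpace ℝ (Fin N) → ℝ) (ε : ℝ) (i : Fin N)
    (x v : EuclideanSpace ℝ (Fin N)) (ω : ℕ × Fin N → ℝ) (n : ℕ) (s : ℝ) : ℝ :=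
  drive U i (skeleton U ε x v ω n).2.1 (skeleton U ε x v ω n).2.2 s

theorem continuous_pathDrive (hU : ∀ i, Continuous (pd U i)) (n : ℕ) :
    Continuous (pathDrive U ε i x v ω n) := continuous_drive hU _ _ _

/-- Valid for ties as well: every coordinate attaining the minimum counts as ringing and is
reversed, so ties need not be excluded. -/
theorem skeleton_succ_vel (n : ℕ) (j : Fin N) :
    (Rings U ε x v j ω n → (skeleton U ε x v ω (n + 1)).2.2 j = -(skeleton U ε x v ω n).2.2 j) ∧
    (¬ Rings U ε x v j ω n →
      (skeleton U ε x v ω (n + 1)).2.2 j = (skeleton U ε x v ω n).2.2 j) :=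
  ⟨fun h => if_pos h, fun h => if_neg h⟩

theorem isSign_skeleton (hv : IsSign v) (n : ℕ) : IsSign (skeleton U ε x v ω n).2.2 := by
  induction n with
  | zero => exact hv
  | succ n ih =>
    intro j
    by_cases h : Rings U ε x v j ω n
    · rw [(skeleton_succ_vel n j).1 h]
      rcases ih j with h | h <;> simp [h]
    · rw [(skeleton_succ_vel n j).2 h]; exact ih j

theorem pathDrive_succ (n : ℕ) :
    (Rings U ε x v i ω n → pathDrive U ε i x v ω (n + 1) 0
      = -pathDrive U ε i x v ω n (flightTime U ε x v ω n).toReal) ∧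
    (¬ Rings U ε x v i ω n → pathDrive U ε i x v ω (n + 1) 0
      = pathDrive U ε i x v ω n (flightTime U ε x v ω n).toReal) := by
  have hX : (skeleton U ε x v ω (n + 1)).2.1 = (skeleton U ε x v ω n).2.1
    + (flightTime U ε x v ω n).toReal • (skeleton U ε x v ω n).2.2 := rfl
  refine ⟨fun h => ?_, fun h => ?_⟩
  · simp only [pathDrive, drive, zero_smul, add_zero]
    rw [(skeleton_succ_vel n i).1 h, hX, neg_mul]
  · simp only [pathDrive, drive, zero_smul, add_zero]
    rw [(skeleton_succ_vel n i).2 h, hX]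

theorem Active.of_le {m n : ℕ} (h : Active U ε B T x v ω n) (hmn : m ≤ n) :
    Active U ε B T x v ω m := by
  induction n with
  | zero => obtain rfl : m = 0 := by omega
            exact h
  | succ n ih =>
    rcases hmn.eq_or_lt with rfl | hlt
    · exact h
    · exact ih h.1 (by omega)

theorem Active.flightTime_ne_top {n : ℕ} (h : Active U ε B T x v ω (n + 1)) :
    flightTime U ε x v ω n ≠ ∞ :=
  (h.2.trans_lt (horizon_ne_top B T x v ω n).lt_top).ne

theorem Active.activeLen_eq {n : ℕ} (h : Active U ε B T x v ω (n + 1)) :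
    activeLen U ε B T x v ω n = (flightTime U ε x v ω n).toReal := by
  rw [activeLen, min_eq_left h.2]

theorem activeLen_nonneg (n : ℕ) : 0 ≤ activeLen U ε B T x v ω n := ENNReal.toReal_nonneg

theorem ofReal_activeLen (n : ℕ) : ENNReal.ofReal (activeLen U ε B T x v ω n)
    = min (flightTime U ε x v ω n) (horizon U ε B T x v ω n) :=
  ENNReal.ofReal_toReal ((min_le_right _ _).trans_lt (horizon_ne_top B T x v ω n).lt_top).ne

theorem Active.time_le {n : ℕ} (h : Active U ε B T x v ω n) :
    (skeleton U ε x v ω n).1 ≤ ENNReal.ofReal T := by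
  induction n with
  | zero => exact zero_le
  | succ n ih =>
    have h1 := ih h.1
    have h2 : flightTime U ε x v ω n ≤ ENNReal.ofReal T - (skeleton U ε x v ω n).1 :=
      h.2.trans (min_le_right _ _)
    calc (skeleton U ε x v ω (n + 1)).1
        = (skeleton U ε x v ω n).1 + flightTime U ε x v ω n := rfl
      _ ≤ (skeleton U ε x v ω n).1 + (ENNReal.ofReal T - (skeleton U ε x v ω n).1) := by gcongr
      _ = ENNReal.ofReal T := add_tsub_cancel_of_le h1

theorem Active.time_ne_top {n : ℕ} (h : Active U ε B T x v ω n) :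
    (skeleton U ε x v ω n).1 ≠ ∞ := (h.time_le.trans_lt ENNReal.ofReal_lt_top).ne

theorem Active.time_succ {n : ℕ} (h : Active U ε B T x v ω (n + 1)) :
    (skeleton U ε x v ω (n + 1)).1.toReal
      = (skeleton U ε x v ω n).1.toReal + (flightTime U ε x v ω n).toReal :=
  ENNReal.toReal_add h.1.time_ne_top h.flightTime_ne_top

theorem Active.time_add_activeLen_le (hT : 0 ≤ T) {n : ℕ} (h : Active U ε B T x v ω n) :
    (skeleton U ε x v ω n).1.toReal + activeLen U ε B T x v ω n ≤ T := by
  have h1 : (skeleton U ε x v ω n).1 + ENNReal.ofReal (activeLen U ε B T x v ω n)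
      ≤ ENNReal.ofReal T := by
    rw [ofReal_activeLen]
    calc _ ≤ (skeleton U ε x v ω n).1 + (ENNReal.ofReal T - (skeleton U ε x v ω n).1) := by
          gcongr; exact (min_le_right _ _).trans (min_le_right _ _)
      _ = ENNReal.ofReal T := add_tsub_cancel_of_le h.time_le
  have := ENNReal.toReal_mono ENNReal.ofReal_ne_top h1
  rwa [ENNReal.toReal_add h.time_ne_top ENNReal.ofReal_ne_top, ENNReal.toReal_ofReal hT,
    ENNReal.toReal_ofReal (activeLen_nonneg n)] at this

theorem Active.sum_activeLen {n : ℕ} (h : Active U ε B T x v ω n) :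
    ∑ m ∈ Finset.range n, activeLen U ε B T x v ω m = (skeleton U ε x v ω n).1.toReal := by
  induction n with
  | zero => simp [skeleton]
  | succ n ih => rw [Finset.sum_range_succ, ih h.1, h.time_succ, h.activeLen_eq]

theorem Active.mem_region (hB : IsClosed B) (hx : x ∈ B) {n : ℕ} (h : Active U ε B T x v ω n) :
    (skeleton U ε x v ω n).2.1 ∈ B := by
  induction n with
  | zero => exact hx
  | succ n ih =>
    refine mem_of_le_exitRay hB (ih h.1) ENNReal.toReal_nonneg ?_
    change ENNReal.ofReal (flightTime U ε x v ω n).toReal ≤ _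
    rw [ENNReal.ofReal_toReal h.flightTime_ne_top]
    exact h.2.trans (min_le_left _ _)

theorem Active.flight_mem_region (hB : IsClosed B) (hx : x ∈ B) {n : ℕ}
    (h : Active U ε B T x v ω n) :
    ∀ s ∈ Icc 0 (activeLen U ε B T x v ω n),
      (skeleton U ε x v ω n).2.1 + s • (skeleton U ε x v ω n).2.2 ∈ B := by
  intro s hs
  refine mem_of_le_exitRay hB (h.mem_region hB hx) hs.1 ?_
  calc ENNReal.ofReal s ≤ ENNReal.ofReal (activeLen U ε B T x v ω n) :=
        ENNReal.ofReal_le_ofReal hs.2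
    _ ≤ _ := by
        rw [ofReal_activeLen]; exact (min_le_right _ _).trans (min_le_left _ _)

theorem pathDrive_ring_nonneg (hU : ∀ i, Continuous (pd U i)) (hε : 0 < ε)
    (hω : ∀ k, 0 < ω k) {n : ℕ} (h : Active U ε B T x v ω (n + 1)) (hr : Rings U ε x v i ω n) :
    0 ≤ pathDrive U ε i x v ω n (flightTime U ε x v ω n).toReal := by
  have h1 := h.flightTime_ne_top
  rw [← hr] at h1 ⊢
  exact nonneg_at_hitTime (continuous_drive hU i _ _) (inv_nonneg.2 hε.le) (hω _) h1

open Classical in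
/-- The sum of the `k`-th powers of `|∂ᵢU|` over the ringings of `i` at the first `n` events. -/
def jumpSum (U : EuclideanSpace ℝ (Fin N) → ℝ) (ε : ℝ) (i : Fin N)
    (x v : EuclideanSpace ℝ (Fin N)) (ω : ℕ × Fin N → ℝ) (k n : ℕ) : ℝ :=
  ∑ m ∈ Finset.range n, if Rings U ε x v i ω m then
    pathDrive U ε i x v ω m (flightTime U ε x v ω m).toReal ^ k else 0

/-- The integral of the positive part of the signed derivative over the `n`-th flight. -/
def posArea (U : EuclideanSpace ℝ (Fin N) → ℝ) (ε : ℝ) (B : Set (EuclideanSpace ℝ (Fin N)))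
    (T : ℝ) (i : Fin N) (x v : EuclideanSpace ℝ (Fin N)) (ω : ℕ × Fin N → ℝ) (n : ℕ) : ℝ :=
  ∫ s in (0 : ℝ)..activeLen U ε B T x v ω n, max (pathDrive U ε i x v ω n s) 0

/-- A ring lowers Z by twice its height, other events leave Z unchanged, and flights raise it at
rate at most K. -/
theorem Active.jumpSum_one_le (hC : Controlled U i B K M η δ) (hv : IsSign v) (hx : x ∈ B)
    {n : ℕ} (h : Active U ε B T x v ω n) :
    2 * jumpSum U ε i x v ω 1 n + pathDrive U ε i x v ω n 0
      ≤ pathDrive U ε i x v ω 0 0 + K * (skeleton U ε x v ω n).1.toReal := by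
  induction n with
  | zero => simp [jumpSum, skeleton]
  | succ n ih =>
    have h0 := ih h.1
    have h1 := hC.drive_le (isSign_skeleton hv n) (h.1.flight_mem_region hC.isClosed hx)
      (right_mem_Icc.2 (activeLen_nonneg n))
    change pathDrive U ε i x v ω n _ ≤ pathDrive U ε i x v ω n 0 + _ at h1
    rw [h.activeLen_eq] at h1
    rw [h.time_succ]
    simp only [jumpSum] at h0 ⊢
    rw [Finset.sum_range_succ]
    split_ifs with hr
    · rw [(pathDrive_succ n).1 hr]; linarith
    · rw [(pathDrive_succ n).2 hr]; linarith

/-- A ring happens at Z ≥ 0 and leaves Z ≤ 0, so z₊² loses the full square of the height; between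
rings it gains at most 2K times the area. -/
theorem Active.jumpSum_two_le (hC : Controlled U i B K M η δ) (hU : ∀ i, Continuous (pd U i))
    (hε : 0 < ε) (hω : ∀ k, 0 < ω k) (hv : IsSign v) (hx : x ∈ B)
    {n : ℕ} (h : Active U ε B T x v ω n) :
    jumpSum U ε i x v ω 2 n + (max (pathDrive U ε i x v ω n 0) 0) ^ 2
      ≤ (max (pathDrive U ε i x v ω 0 0) 0) ^ 2
        + 2 * K * ∑ m ∈ Finset.range n, posArea U ε B T i x v ω m := by
  induction n with
  | zero => simp [jumpSum]
  | succ n ih =>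
    have h0 := ih h.1
    have h1 := hC.drive_sq_le hU (isSign_skeleton hv n) (h.1.flight_mem_region hC.isClosed hx)
      (right_mem_Icc.2 (activeLen_nonneg n))
    change (max (pathDrive U ε i x v ω n _) 0) ^ 2 ≤ (max (pathDrive U ε i x v ω n 0) 0) ^ 2
      + 2 * K * posArea U ε B T i x v ω n at h1
    rw [h.activeLen_eq] at h1
    simp only [jumpSum] at h0 ⊢
    rw [Finset.sum_range_succ, Finset.sum_range_succ]
    split_ifs with hr
    · have hnn := pathDrive_ring_nonneg hU hε hω h hr
      rw [(pathDrive_succ n).1 hr, max_eq_right (neg_nonpos.2 hnn)]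
      rw [max_eq_left hnn] at h1
      linarith
    · rw [(pathDrive_succ n).2 hr]; linarith

theorem posArea_nonneg (n : ℕ) : 0 ≤ posArea U ε B T i x v ω n :=
  intervalIntegral.integral_nonneg (activeLen_nonneg n) fun _ _ => le_max_right _ _

theorem jumpSum_nonneg (k : ℕ) (hU : ∀ i, Continuous (pd U i)) (hε : 0 < ε)
    (hω : ∀ k, 0 < ω k) {n : ℕ} (h : Active U ε B T x v ω n) : 0 ≤ jumpSum U ε i x v ω k n := by
  refine Finset.sum_nonneg fun m hm => ?_
  split_ifs with hr
  · exact pow_nonneg (pathDrive_ring_nonneg hU hε hω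
      (h.of_le (Finset.mem_range.1 hm)) hr) k
  · exact le_rfl

/-- The signed derivative is bounded by any `w` that dominates the total area. -/
theorem Active.pathDrive_le (hC : Controlled U i B K M η δ) (hU : ∀ i, Continuous (pd U i))
    (hε : 0 < ε) (hω : ∀ k, 0 < ω k) (hv : IsSign v) (hx : x ∈ B) (hxi : pd U i x = 0)
    {w : ℝ} (hw0 : 0 ≤ w)
    (hw : ∀ n, Active U ε B T x v ω n →
      2 * K * ∑ m ∈ Finset.range (n + 1), posArea U ε B T i x v ω m ≤ w ^ 2)
    {n : ℕ} (h : Active U ε B T x v ω n) {s : ℝ} (hs : s ∈ Icc 0 (activeLen U ε B T x v ω n)) :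
    pathDrive U ε i x v ω n s ≤ w := by
  have h0 := h.jumpSum_two_le hC hU hε hω hv hx
  have h1 := hC.drive_sq_le hU (isSign_skeleton hv n) (h.flight_mem_region hC.isClosed hx) hs
  change (max (pathDrive U ε i x v ω n s) 0) ^ 2 ≤ (max (pathDrive U ε i x v ω n 0) 0) ^ 2
      + 2 * K * ∫ r in (0 : ℝ)..s, max (pathDrive U ε i x v ω n r) 0 at h1
  have hcont : Continuous fun r => max (pathDrive U ε i x v ω n r) 0 :=
    (continuous_pathDrive hU n).max continuous_const
  have h2 : ∫ r in (0 : ℝ)..s, max (pathDrive U ε i x v ω n r) 0 ≤ posArea U ε B T i x v ω n :=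
    monotone_primitive hcont (fun _ => le_max_right _ _) hs.2
  have h3 := hw n h
  rw [Finset.sum_range_succ] at h3
  have h4 : pathDrive U ε i x v ω 0 0 = 0 := by simp [pathDrive, drive, skeleton, hxi]
  rw [h4, max_self] at h0
  have h5 := jumpSum_nonneg (i := i) 2 hU hε hω h
  have hK := hC.K_pos
  have h6 : (max (pathDrive U ε i x v ω n s) 0) ^ 2 ≤ w ^ 2 := by nlinarith
  exact (le_max_left _ _).trans (abs_le_of_sq_le_sq' h6 hw0).2

/-- The strip [-w, w] is invariant: the slope condition guards the lower edge during flights, and a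
ring at height at most w lands no lower than -w. -/
theorem Active.abs_pathDrive_le_of_small (hC : Controlled U i B K M η δ)
    (hv : IsSign v) (hx : x ∈ B) (hxi : pd U i x = 0) {w : ℝ} (hw0 : 0 ≤ w) (hwη : w ≤ η)
    (hw : ∀ n, Active U ε B T x v ω n → ∀ s ∈ Icc 0 (activeLen U ε B T x v ω n),
      pathDrive U ε i x v ω n s ≤ w)
    {n : ℕ} (h : Active U ε B T x v ω n) {s : ℝ} (hs : s ∈ Icc 0 (activeLen U ε B T x v ω n)) :
    |pathDrive U ε i x v ω n s| ≤ w := by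
  have hstart : ∀ n, Active U ε B T x v ω n → -w ≤ pathDrive U ε i x v ω n 0 := by
    intro n h
    induction n with
    | zero => simp [pathDrive, drive, skeleton, hxi, hw0]
    | succ n ih =>
      have h1 := hw n h.1 _ (right_mem_Icc.2 (activeLen_nonneg n))
      have h2 := hC.neg_le_drive (isSign_skeleton hv n)
        (h.1.flight_mem_region hC.isClosed hx) hw0 hwη (ih h.1)
        (right_mem_Icc.2 (activeLen_nonneg n))
      change _ ≤ pathDrive U ε i x v ω n _ at h2
      rw [h.activeLen_eq] at h1 h2
      by_cases hr : Rings U ε x v i ω n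
      · rw [(pathDrive_succ n).1 hr]; linarith
      · rw [(pathDrive_succ n).2 hr]; linarith
  exact abs_le.2 ⟨hC.neg_le_drive (isSign_skeleton hv n)
    (h.flight_mem_region hC.isClosed hx) hw0 hwη (hstart n h) hs, hw n h s hs⟩

theorem Active.abs_pathDrive_le (hC : Controlled U i B K M η δ)
    (hv : IsSign v) (hx : x ∈ B) (hxi : pd U i x = 0) {w : ℝ} (hw0 : 0 ≤ w)
    (hw : ∀ n, Active U ε B T x v ω n → ∀ s ∈ Icc 0 (activeLen U ε B T x v ω n),
      pathDrive U ε i x v ω n s ≤ w)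
    {n : ℕ} (h : Active U ε B T x v ω n) {s : ℝ} (hs : s ∈ Icc 0 (activeLen U ε B T x v ω n)) :
    |pathDrive U ε i x v ω n s| ≤ (1 + M / η) * w := by
  have hM : 0 ≤ M / η := div_nonneg hC.M_nonneg hC.η_pos.le
  rcases le_or_gt w η with hwη | hwη
  · have := h.abs_pathDrive_le_of_small hC hv hx hxi hw0 hwη hw hs
    nlinarith
  · have h1 : |pathDrive U ε i x v ω n s| ≤ M := by
      rw [pathDrive, abs_drive (isSign_skeleton hv n)]
      exact hC.abs_le _ (h.flight_mem_region hC.isClosed hx s hs)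
    have h2 : M ≤ M / η * w := by
      rw [div_mul_eq_mul_div, le_div_iff₀ hC.η_pos]
      exact mul_le_mul_of_nonneg_left hwη.le hC.M_nonneg
    linarith

/-- The first telescoping with reversed inequalities: as long as |Z| ≤ η, every flight raises Z at
rate at least δ. -/
theorem Active.le_jumpSum_of_small (hC : Controlled U i B K M η δ)
    (hv : IsSign v) (hx : x ∈ B)
    (hw : ∀ n, Active U ε B T x v ω n → ∀ s ∈ Icc 0 (activeLen U ε B T x v ω n),
      |pathDrive U ε i x v ω n s| ≤ η)
    {n : ℕ} (h : Active U ε B T x v ω n) :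
    pathDrive U ε i x v ω 0 0 + δ * (skeleton U ε x v ω n).1.toReal
      ≤ 2 * jumpSum U ε i x v ω 1 n + pathDrive U ε i x v ω n 0 := by
  induction n with
  | zero => simp [jumpSum, skeleton]
  | succ n ih =>
    have h0 := ih h.1
    have h1 := hC.le_drive (isSign_skeleton hv n) (h.1.flight_mem_region hC.isClosed hx)
      (hw n h.1) (right_mem_Icc.2 (activeLen_nonneg n))
    change pathDrive U ε i x v ω n 0 + _ ≤ pathDrive U ε i x v ω n _ at h1
    rw [h.activeLen_eq] at h1
    rw [h.time_succ]
    simp only [jumpSum] at h0 ⊢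
    rw [Finset.sum_range_succ]
    split_ifs with hr
    · rw [(pathDrive_succ n).1 hr]; linarith
    · rw [(pathDrive_succ n).2 hr]; linarith

/-- If the `n`-th flight is still going on at time `T`, then the total of the ringing heights is
at least of order `T`, up to a multiple of `w`. -/
theorem Active.le_jumpSum (hC : Controlled U i B K M η δ) (hU : ∀ i, Continuous (pd U i))
    (hε : 0 < ε) (hω : ∀ k, 0 < ω k)
    (hv : IsSign v) (hx : x ∈ B) (hxi : pd U i x = 0) {w : ℝ} (hw0 : 0 ≤ w)
    (hw : ∀ n, Active U ε B T x v ω n → ∀ s ∈ Icc 0 (activeLen U ε B T x v ω n),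
      pathDrive U ε i x v ω n s ≤ w)
    {n : ℕ} (h : Active U ε B T x v ω n) (hT : 0 ≤ T)
    (hlast : (skeleton U ε x v ω n).1.toReal + activeLen U ε B T x v ω n = T) :
    δ * T ≤ 2 * jumpSum U ε i x v ω 1 n + (1 + δ * T / η) * w := by
  have hδT : 0 ≤ δ * T := mul_nonneg hC.δ_pos.le hT
  have hJ := jumpSum_nonneg (i := i) 1 hU hε hω h
  rcases le_or_gt w η with hwη | hwη
  · have hsm : ∀ n, Active U ε B T x v ω n → ∀ s ∈ Icc 0 (activeLen U ε B T x v ω n),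
        |pathDrive U ε i x v ω n s| ≤ η := fun n h s hs =>
      (h.abs_pathDrive_le_of_small hC hv hx hxi hw0 hwη hw hs).trans hwη
    have h0 := h.le_jumpSum_of_small hC hv hx hsm
    have h1 := hC.le_drive (isSign_skeleton hv n) (h.flight_mem_region hC.isClosed hx)
      (hsm n h) (right_mem_Icc.2 (activeLen_nonneg n))
    change pathDrive U ε i x v ω n 0 + _ ≤ pathDrive U ε i x v ω n _ at h1
    have h2 := hw n h _ (right_mem_Icc.2 (activeLen_nonneg n))
    have h4 : pathDrive U ε i x v ω 0 0 = 0 := by simp [pathDrive, drive, skeleton, hxi]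
    have h5 : 0 ≤ δ * T / η * w := by have := hC.η_pos; positivity
    have h6 : δ * T = δ * (skeleton U ε x v ω n).1.toReal + δ * activeLen U ε B T x v ω n := by
      rw [← mul_add, hlast]
    linarith
  · have h2 : δ * T ≤ δ * T / η * w := by
      rw [div_mul_eq_mul_div, le_div_iff₀ hC.η_pos]
      exact mul_le_mul_of_nonneg_left hwη.le hδT
    linarith

end Path

/-! ### Expected area, expected number of rings, and non-explosion. -/

section Expectation

variable {U : EuclideanSpace ℝ (Fin N) → ℝ} {ε : ℝ} {i : Fin N}
  {B : Set (EuclideanSpace ℝ (Fin N))} {T : ℝ} {K M η δ : ℝ}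
  {x v : EuclideanSpace ℝ (Fin N)} {ω : ℕ × Fin N → ℝ}

/-- The number of ringings of coordinate `i` before `T` and before the exit from `B`. -/
def ringCount (U : EuclideanSpace ℝ (Fin N) → ℝ) (ε : ℝ) (B : Set (EuclideanSpace ℝ (Fin N)))
    (T : ℝ) (i : Fin N) (x v : EuclideanSpace ℝ (Fin N)) (ω : ℕ × Fin N → ℝ) : ℝ≥0∞ :=
  ∑' n, {ω | Active U ε B T x v ω (n + 1) ∧ Rings U ε x v i ω n}.indicator (fun _ => 1) ω

/-- The sum of the values of `|∂ᵢU|` at the ringings of coordinate `i`. -/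
def ringSum (U : EuclideanSpace ℝ (Fin N) → ℝ) (ε : ℝ) (B : Set (EuclideanSpace ℝ (Fin N)))
    (T : ℝ) (i : Fin N) (x v : EuclideanSpace ℝ (Fin N)) (ω : ℕ × Fin N → ℝ) : ℝ≥0∞ :=
  ∑' n, {ω | Active U ε B T x v ω (n + 1) ∧ Rings U ε x v i ω n}.indicator
    (fun ω => ENNReal.ofReal (pathDrive U ε i x v ω n (flightTime U ε x v ω n).toReal)) ω

/-- The time integral of the positive part of the signed derivative. -/
def totalArea (U : EuclideanSpace ℝ (Fin N) → ℝ) (ε : ℝ) (B : Set (EuclideanSpace ℝ (Fin N)))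
    (T : ℝ) (i : Fin N) (x v : EuclideanSpace ℝ (Fin N)) (ω : ℕ × Fin N → ℝ) : ℝ≥0∞ :=
  ∑' n, {ω | Active U ε B T x v ω n}.indicator
    (fun ω => ∫⁻ s in Ioo 0 (activeLen U ε B T x v ω n),
      ENNReal.ofReal (pathDrive U ε i x v ω n s)) ω

/-- The total active time. -/
def totalTime (U : EuclideanSpace ℝ (Fin N) → ℝ) (ε : ℝ) (B : Set (EuclideanSpace ℝ (Fin N)))
    (T : ℝ) (x v : EuclideanSpace ℝ (Fin N)) (ω : ℕ × Fin N → ℝ) : ℝ≥0∞ :=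
  ∑' n, {ω | Active U ε B T x v ω n}.indicator
    (fun ω => ENNReal.ofReal (activeLen U ε B T x v ω n)) ω

/-- Used with P an activity condition, which holds on an initial segment of indices: the bound is
needed only for partial sums that end at an active index. -/
theorem tsum_le_of_initial {F : ℕ → ℝ≥0∞} {P : ℕ → Prop} {c : ℝ≥0∞}
    (h0 : ∀ n, ¬ P n → F n = 0) (h : ∀ n, P n → ∑ m ∈ Finset.range (n + 1), F m ≤ c) :
    ∑' n, F n ≤ c := by
  refine ENNReal.tsum_le_of_sum_range_le fun n => ?_
  induction n with
  | zero => simp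
  | succ n ih =>
    by_cases hn : P n
    · exact h n hn
    · rw [Finset.sum_range_succ, h0 n hn, add_zero]; exact ih

theorem totalTime_le (hT : 0 ≤ T) : totalTime U ε B T x v ω ≤ ENNReal.ofReal T := by
  refine tsum_le_of_initial (P := fun n => Active U ε B T x v ω n)
    (fun n hn => indicator_of_notMem (s := {ω | Active U ε B T x v ω n}) hn _) fun n hn => ?_
  have : ∀ m ∈ Finset.range (n + 1), {ω | Active U ε B T x v ω m}.indicator
      (fun ω => ENNReal.ofReal (activeLen U ε B T x v ω m)) ω
      = ENNReal.ofReal (activeLen U ε B T x v ω m) := fun m hm =>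
    indicator_of_mem (s := {ω | Active U ε B T x v ω m})
      (hn.of_le (Nat.lt_succ_iff.1 (Finset.mem_range.1 hm))) _
  rw [Finset.sum_congr rfl this, ← ENNReal.ofReal_sum_of_nonneg fun m _ => activeLen_nonneg m]
  refine ENNReal.ofReal_le_ofReal ?_
  rw [Finset.sum_range_succ, hn.sum_activeLen]
  exact hn.time_add_activeLen_le hT

theorem ringSum_le (hC : Controlled U i B K M η δ) (hU : ∀ i, Continuous (pd U i))
    (hε : 0 < ε) (hω : ∀ k, 0 < ω k) (hv : IsSign v) (hx : x ∈ B) (hxi : pd U i x = 0)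
    (hT : 0 ≤ T) : ringSum U ε B T i x v ω ≤ ENNReal.ofReal ((M + K * T) / 2) := by
  refine tsum_le_of_initial (P := fun n => Active U ε B T x v ω (n + 1))
    (fun n hn => indicator_of_notMem
      (s := {ω | Active U ε B T x v ω (n + 1) ∧ Rings U ε x v i ω n}) (fun h => hn h.1) _)
    fun n hn => ?_
  have hle : ∀ m ∈ Finset.range (n + 1),
      {ω | Active U ε B T x v ω (m + 1) ∧ Rings U ε x v i ω m}.indicator
        (fun ω => ENNReal.ofReal (pathDrive U ε i x v ω m (flightTime U ε x v ω m).toReal)) ω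
      = ENNReal.ofReal (open Classical in if Rings U ε x v i ω m then
          pathDrive U ε i x v ω m (flightTime U ε x v ω m).toReal ^ 1 else 0) := by
    intro m hm
    have hact := hn.of_le (m := m + 1) (by have := Finset.mem_range.1 hm; omega)
    by_cases hr : Rings U ε x v i ω m
    · rw [if_pos hr, pow_one]
      exact indicator_of_mem
        (s := {ω | Active U ε B T x v ω (m + 1) ∧ Rings U ε x v i ω m}) ⟨hact, hr⟩ _
    · rw [if_neg hr, ENNReal.ofReal_zero]
      exact indicator_of_notMem
        (s := {ω | Active U ε B T x v ω (m + 1) ∧ Rings U ε x v i ω m}) (fun h => hr h.2) _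
  rw [Finset.sum_congr rfl hle, ← ENNReal.ofReal_sum_of_nonneg]
  · refine ENNReal.ofReal_le_ofReal ?_
    change jumpSum U ε i x v ω 1 (n + 1) ≤ _
    have h1 := hn.jumpSum_one_le hC hv hx
    have h2 : pathDrive U ε i x v ω 0 0 = 0 := by simp [pathDrive, drive, skeleton, hxi]
    -- The telescoped sum still contains the current value of Z, which is at least -M.
    have h3 := hC.abs_le _ (hn.flight_mem_region hC.isClosed hx 0
      (left_mem_Icc.2 (activeLen_nonneg _)))
    rw [← abs_drive (isSign_skeleton hv (n + 1))] at h3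
    have h4 := (abs_le.1 h3).1
    change -M ≤ pathDrive U ε i x v ω (n + 1) 0 at h4
    have h5 : (skeleton U ε x v ω (n + 1)).1.toReal ≤ T := by
      have := hn.time_add_activeLen_le hT
      linarith [activeLen_nonneg (U := U) (ε := ε) (B := B) (T := T) (x := x) (v := v)
        (ω := ω) (n + 1)]
    have := mul_le_mul_of_nonneg_left h5 hC.K_pos.le
    linarith
  · intro m hm
    split_ifs with hr
    · exact pow_nonneg (pathDrive_ring_nonneg hU hε hω
        (hn.of_le (by have := Finset.mem_range.1 hm; omega)) hr) 1
    · exact le_rfl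

theorem lintegral_flight_eq (hU : ∀ i, Continuous (pd U i)) (n : ℕ) :
    ∫⁻ s in Ioo 0 (activeLen U ε B T x v ω n), ENNReal.ofReal (pathDrive U ε i x v ω n s)
      = ENNReal.ofReal (posArea U ε B T i x v ω n) := by
  have hcont : Continuous fun r => max (pathDrive U ε i x v ω n r) 0 :=
    (continuous_pathDrive hU n).max continuous_const
  rw [posArea, intervalIntegral.integral_of_le (activeLen_nonneg n),
    ofReal_integral_eq_lintegral_ofReal, setLIntegral_congr Ioo_ae_eq_Ioc]
  · refine lintegral_congr fun s => ?_
    rcases le_total (pathDrive U ε i x v ω n s) 0 with h | h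
    · rw [max_eq_right h, ENNReal.ofReal_of_nonpos h, ENNReal.ofReal_zero]
    · rw [max_eq_left h]
  · exact (hcont.integrableOn_Icc).mono_set Ioc_subset_Icc_self
  · exact Eventually.of_forall fun _ => le_max_right _ _

theorem sum_posArea_le (hU : ∀ i, Continuous (pd U i)) (hfin : totalArea U ε B T i x v ω ≠ ∞)
    {n : ℕ} (hn : Active U ε B T x v ω n) :
    ∑ m ∈ Finset.range (n + 1), posArea U ε B T i x v ω m
      ≤ (totalArea U ε B T i x v ω).toReal := by
  rw [← ENNReal.ofReal_le_iff_le_toReal hfin,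
    ENNReal.ofReal_sum_of_nonneg fun m _ => posArea_nonneg m]
  refine le_trans (le_of_eq (Finset.sum_congr rfl fun m hm => ?_))
    (ENNReal.sum_le_tsum (Finset.range (n + 1)))
  rw [← lintegral_flight_eq hU]
  exact (indicator_of_mem (s := {ω | Active U ε B T x v ω m})
    (hn.of_le (Nat.lt_succ_iff.1 (Finset.mem_range.1 hm)))
    (fun ω => ∫⁻ s in Ioo 0 (activeLen U ε B T x v ω m),
      ENNReal.ofReal (pathDrive U ε i x v ω m s))).symm

theorem measurable_pathDrive (hU : ∀ i, Continuous (pd U i)) (hε : 0 < ε) (n : ℕ) :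
    Measurable (Function.uncurry fun (ω : ℕ × Fin N → ℝ) s => pathDrive U ε i x v ω n s) :=
  measurable_drive_path hU hε x v i n

theorem measurable_area (hU : ∀ i, Continuous (pd U i)) (hε : 0 < ε) (hB : IsClosed B) (n : ℕ) :
    Measurable ({ω | Active U ε B T x v ω n}.indicator
      (fun ω => ∫⁻ s in Ioo 0 (activeLen U ε B T x v ω n),
        ENNReal.ofReal (pathDrive U ε i x v ω n s))) :=
  (measurable_lintegral_activeLen hU hε hB T x v n
    (f := fun ω s => ENNReal.ofReal (pathDrive U ε i x v ω n s))
    (measurable_pathDrive hU hε n).ennreal_ofReal).indicator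
    (measurableSet_active hU hε hB T x v n)

theorem measurable_totalArea (hU : ∀ i, Continuous (pd U i)) (hε : 0 < ε) (hB : IsClosed B) :
    Measurable (totalArea U ε B T i x v) :=
  Measurable.tsum fun n => measurable_area hU hε hB n

theorem measurable_ringIndicator (hU : ∀ i, Continuous (pd U i)) (hε : 0 < ε)
    (hB : IsClosed B) (n : ℕ) :
    Measurable ({ω | Active U ε B T x v ω (n + 1) ∧ Rings U ε x v i ω n}.indicator
      fun _ => (1 : ℝ≥0∞)) :=
  measurable_const.indicator
    ((measurableSet_active hU hε hB T x v (n + 1)).inter (measurableSet_rings hU hε x v i n))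

theorem measurable_ringCount (hU : ∀ i, Continuous (pd U i)) (hε : 0 < ε) (hB : IsClosed B) :
    Measurable (ringCount U ε B T i x v) :=
  Measurable.tsum fun n => measurable_ringIndicator hU hε hB n

theorem ae_clock_pos : ∀ᵐ ω ∂(clockMeasure N), ∀ k, 0 < ω k := by
  rw [ae_all_iff]
  intro k
  have h := (measurePreserving_eval_infinitePi (fun _ : ℕ × Fin N => expMeasure 1) k)
  have h0 : ∀ᵐ u ∂(expMeasure 1), 0 < u := by
    have h1 : expMeasure 1 (Ioi (0 : ℝ)) = 1 := by simpa using expMeasure_Ioi le_rfl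
    exact (prob_compl_eq_zero_iff measurableSet_Ioi).2 h1
  exact h.quasiMeasurePreserving.ae h0

/-- The expected number of ringings is the expected integral of the switching rate. -/
theorem lintegral_ringCount (hU : ∀ i, Continuous (pd U i)) (hε : 0 < ε) (hB : IsClosed B) :
    ∫⁻ ω, ringCount U ε B T i x v ω ∂(clockMeasure N)
      = ENNReal.ofReal ε⁻¹ * ∫⁻ ω, totalArea U ε B T i x v ω ∂(clockMeasure N) := by
  unfold ringCount totalArea
  rw [lintegral_tsum fun n => (measurable_ringIndicator hU hε hB n).aemeasurable,
    lintegral_tsum fun n => (measurable_area hU hε hB n).aemeasurable, ← ENNReal.tsum_mul_left]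
  refine tsum_congr fun n => ?_
  rw [lintegral_rings hU hε hB T x v i n (g := fun _ => 1) measurable_const,
    ← lintegral_const_mul _ (measurable_area hU hε hB n)]
  refine lintegral_congr fun ω => ?_
  by_cases ha : Active U ε B T x v ω n
  swap
  · have hmem : ω ∉ {ω | Active U ε B T x v ω n} := ha
    rw [indicator_of_notMem hmem, indicator_of_notMem hmem, mul_zero]
  have hmem : ω ∈ {ω | Active U ε B T x v ω n} := ha
  rw [indicator_of_mem hmem, indicator_of_mem hmem]
  rw [← lintegral_const_mul _ (by
    exact (continuous_pathDrive hU n).measurable.ennreal_ofReal)]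
  refine lintegral_congr fun s => ?_
  rw [mul_one, ENNReal.ofReal_mul (inv_nonneg.2 hε.le)]
  congr 1
  change ENNReal.ofReal (max (pathDrive U ε i x v ω n s) 0) = _
  rcases le_total (pathDrive U ε i x v ω n s) 0 with h | h
  · rw [max_eq_right h, ENNReal.ofReal_of_nonpos h, ENNReal.ofReal_zero]
  · rw [max_eq_left h]

/-- This is (r - z)² ≥ 0 with r = √ε. The quadratic term is written as rate times height, the form
in which the compensator identity returns the sum of ring heights. -/
theorem ofReal_le_amgm {ε r : ℝ} (hr : 0 < r) (hrε : r ^ 2 = ε) (z : ℝ) :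
    ENNReal.ofReal z ≤ ENNReal.ofReal (r / 2) +
      ENNReal.ofReal (r / 2) * (ENNReal.ofReal (ε⁻¹ * max z 0) * ENNReal.ofReal z) := by
  rcases le_total z 0 with h | h
  · rw [ENNReal.ofReal_of_nonpos h]; exact zero_le
  · have hε : 0 < ε := hrε ▸ by positivity
    rw [max_eq_left h, ← ENNReal.ofReal_mul (by positivity), ← ENNReal.ofReal_mul (by positivity),
      ← ENNReal.ofReal_add (by positivity) (by positivity)]
    refine ENNReal.ofReal_le_ofReal ?_
    have : r / 2 + r / 2 * (ε⁻¹ * z * z) - z = (r - z) ^ 2 / (2 * r) := by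
      subst hrε; field_simp; ring
    have h2 : 0 ≤ (r - z) ^ 2 / (2 * r) := by positivity
    linarith

/-- The inequality z ≤ r/2 + (r/2) ε⁻¹ z², integrated over the active time, leaves the total time,
at most T, and the compensated quadratic part, whose expectation is that of `ringSum`. -/
theorem lintegral_totalArea_le (hC : Controlled U i B K M η δ) (hU : ∀ i, Continuous (pd U i))
    (hv : IsSign v) (hx : x ∈ B) (hxi : pd U i x = 0)
    (hT : 0 ≤ T) {r : ℝ} (hr : 0 < r) (hrε : r ^ 2 = ε) :
    ∫⁻ ω, totalArea U ε B T i x v ω ∂(clockMeasure N)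
      ≤ ENNReal.ofReal (r / 2 * (T + (M + K * T) / 2)) := by
  have hε : 0 < ε := hrε ▸ by positivity
  have hB := hC.isClosed
  have hmt := fun n => (measurable_activeLen hU hε hB T x v n).ennreal_ofReal.indicator
    (measurableSet_active hU hε hB T x v n)
  set R : ℕ → (ℕ × Fin N → ℝ) → ℝ≥0∞ := fun n =>
    {ω | Active U ε B T x v ω n}.indicator
        (fun ω => ∫⁻ s in Ioo 0 (activeLen U ε B T x v ω n),
          ENNReal.ofReal (ε⁻¹ * max (drive U i (skeleton U ε x v ω n).2.1
            (skeleton U ε x v ω n).2.2 s) 0) *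
          ENNReal.ofReal (drive U i (skeleton U ε x v ω n).2.1 (skeleton U ε x v ω n).2.2 s))
  have hstep : ∀ n, ∫⁻ ω, {ω | Active U ε B T x v ω n}.indicator
      (fun ω => ∫⁻ s in Ioo 0 (activeLen U ε B T x v ω n),
        ENNReal.ofReal (pathDrive U ε i x v ω n s)) ω ∂(clockMeasure N)
      ≤ ENNReal.ofReal (r / 2) * ∫⁻ ω, {ω | Active U ε B T x v ω n}.indicator
          (fun ω => ENNReal.ofReal (activeLen U ε B T x v ω n)) ω ∂(clockMeasure N)
        + ENNReal.ofReal (r / 2) * ∫⁻ ω,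
          {ω | Active U ε B T x v ω (n + 1) ∧ Rings U ε x v i ω n}.indicator
          (fun ω => ENNReal.ofReal (pathDrive U ε i x v ω n (flightTime U ε x v ω n).toReal)) ω
            ∂(clockMeasure N) := by
    intro n
    have := lintegral_rings hU hε hB T x v i n (g := fun z => ENNReal.ofReal z)
      ENNReal.measurable_ofReal
    change _ = ∫⁻ ω, R n ω ∂_ at this
    rw [show (∫⁻ ω, {ω | Active U ε B T x v ω (n + 1) ∧ Rings U ε x v i ω n}.indicator
          (fun ω => ENNReal.ofReal (pathDrive U ε i x v ω n (flightTime U ε x v ω n).toReal)) ω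
            ∂(clockMeasure N)) = ∫⁻ ω, R n ω ∂(clockMeasure N) from this,
      ← lintegral_const_mul _ (hmt n), ← lintegral_const_mul' _ _ ENNReal.ofReal_ne_top,
      ← lintegral_add_left ((hmt n).const_mul _)]
    refine lintegral_mono fun ω => ?_
    simp only [R]
    by_cases ha : Active U ε B T x v ω n
    · have hmem : ω ∈ {ω | Active U ε B T x v ω n} := ha
      rw [indicator_of_mem hmem, indicator_of_mem hmem, indicator_of_mem hmem]
      calc _ ≤ ∫⁻ s in Ioo 0 (activeLen U ε B T x v ω n), (ENNReal.ofReal (r / 2) +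
              ENNReal.ofReal (r / 2) * (ENNReal.ofReal (ε⁻¹ * max (drive U i
                (skeleton U ε x v ω n).2.1 (skeleton U ε x v ω n).2.2 s) 0) *
              ENNReal.ofReal (drive U i (skeleton U ε x v ω n).2.1
                (skeleton U ε x v ω n).2.2 s))) :=
            lintegral_mono fun s => ofReal_le_amgm hr hrε _
        _ = _ := by
            rw [lintegral_add_left measurable_const, lintegral_const_mul' _ _ ENNReal.ofReal_ne_top]
            simp
    · have hmem : ω ∉ {ω | Active U ε B T x v ω n} := ha
      rw [indicator_of_notMem hmem]; exact zero_le
  have hsum : ∑' n, ∫⁻ ω, {ω | Active U ε B T x v ω (n + 1) ∧ Rings U ε x v i ω n}.indicator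
      (fun ω => ENNReal.ofReal (pathDrive U ε i x v ω n (flightTime U ε x v ω n).toReal)) ω
        ∂(clockMeasure N) ≤ ENNReal.ofReal ((M + K * T) / 2) := by
    rw [← lintegral_tsum]
    · calc _ ≤ ∫⁻ _, ENNReal.ofReal ((M + K * T) / 2) ∂(clockMeasure N) := by
            refine lintegral_mono_ae ?_
            filter_upwards [ae_clock_pos] with ω hω
            exact ringSum_le hC hU hε hω hv hx hxi hT
        _ = _ := by simp
    · intro n
      refine (Measurable.indicator ?_ ((measurableSet_active hU hε hB T x v (n + 1)).inter
        (measurableSet_rings hU hε x v i n))).aemeasurable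
      exact ((measurable_pathDrive hU hε n).comp (measurable_id.prodMk
        (measurable_flightTime hU hε x v n).ennreal_toReal)).ennreal_ofReal
  have htime : ∑' n, ∫⁻ ω, {ω | Active U ε B T x v ω n}.indicator
      (fun ω => ENNReal.ofReal (activeLen U ε B T x v ω n)) ω ∂(clockMeasure N)
      ≤ ENNReal.ofReal T := by
    rw [← lintegral_tsum fun n => (hmt n).aemeasurable]
    calc _ ≤ ∫⁻ _, ENNReal.ofReal T ∂(clockMeasure N) := lintegral_mono fun ω => totalTime_le hT
      _ = _ := by simp
  have hK := hC.K_pos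
  have hM := hC.M_nonneg
  unfold totalArea
  rw [lintegral_tsum fun n => (measurable_area hU hε hB n).aemeasurable]
  calc _ ≤ _ := ENNReal.tsum_le_tsum hstep
    _ ≤ ENNReal.ofReal (r / 2) * ENNReal.ofReal T
        + ENNReal.ofReal (r / 2) * ENNReal.ofReal ((M + K * T) / 2) := by
      rw [ENNReal.tsum_add, ENNReal.tsum_mul_left, ENNReal.tsum_mul_left]
      gcongr
    _ = _ := by
      rw [← mul_add, ← ENNReal.ofReal_add hT (by positivity), ← ENNReal.ofReal_mul (by positivity)]

theorem exists_rings (hN : Nonempty (Fin N)) (n : ℕ) : ∃ j, Rings U ε x v j ω n :=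
  exists_eq_ciInf_of_finite (f := fun j => ringTime U ε j (skeleton U ε x v ω n).2.1
    (skeleton U ε x v ω n).2.2 (ω (n, j)))

theorem norm_isSign (hv : IsSign v) : ‖v‖ = √N := by
  rw [EuclideanSpace.norm_eq]
  congr 1
  have : ∀ j, ‖v j‖ ^ 2 = 1 := fun j => by rcases hv j with h | h <;> simp [h]
  rw [Finset.sum_congr rfl fun j _ => this j]
  simp

theorem Active.dist_skeleton_le (hv : IsSign v) {n : ℕ} (h : Active U ε B T x v ω n) :
    ‖(skeleton U ε x v ω n).2.1 - x‖ ≤ √N * (skeleton U ε x v ω n).1.toReal := by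
  induction n with
  | zero => simp [skeleton]
  | succ n ih =>
    rw [h.time_succ]
    have hX : (skeleton U ε x v ω (n + 1)).2.1 - x = ((skeleton U ε x v ω n).2.1 - x)
      + (flightTime U ε x v ω n).toReal • (skeleton U ε x v ω n).2.2 := by
      change (skeleton U ε x v ω n).2.1 + (flightTime U ε x v ω n).toReal •
        (skeleton U ε x v ω n).2.2 - x = _
      abel
    rw [hX]
    refine (norm_add_le _ _).trans ?_
    rw [norm_smul, norm_isSign (isSign_skeleton hv n), Real.norm_of_nonneg ENNReal.toReal_nonneg]
    linarith [ih h.1]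

theorem Active.dist_flight_le (hv : IsSign v) {n : ℕ} (h : Active U ε B T x v ω n) {s : ℝ}
    (hs : 0 ≤ s) :
    ‖(skeleton U ε x v ω n).2.1 + s • (skeleton U ε x v ω n).2.2 - x‖
      ≤ √N * ((skeleton U ε x v ω n).1.toReal + s) := by
  rw [add_sub_right_comm]
  refine (norm_add_le _ _).trans ?_
  rw [norm_smul, norm_isSign (isSign_skeleton hv n), Real.norm_of_nonneg hs]
  linarith [h.dist_skeleton_le hv]

/-- Almost surely only finitely many events happen before time `T`. -/
theorem ae_exists_not_active (hU : ∀ i, Continuous (pd U i)) (hε : 0 < ε) (hv : IsSign v)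
    (hN : Nonempty (Fin N)) (hT : 0 ≤ T) :
    ∀ᵐ ω ∂(clockMeasure N), ∃ n, ¬ Active U ε univ T x v ω n := by
  have hbd : ∀ j, ∃ M, 0 ≤ M ∧ ∀ y, ‖y - x‖ ≤ √N * T → |pd U j y| ≤ M := by
    intro j
    obtain ⟨M, hM⟩ := (isCompact_closedBall x (√N * T)).exists_bound_of_continuousOn
      (hU j).continuousOn
    refine ⟨max M 0, le_max_right _ _, fun y hy => (hM y ?_).trans (le_max_left _ _)⟩
    rwa [mem_closedBall_iff_norm]
  choose M hM0 hM using hbd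
  -- At speed √N the path stays in a fixed ball until T, where every partial derivative is bounded.
  -- Each expected ring count is therefore finite, even without a region B.
  have harea : ∀ j ω, totalArea U ε univ T j x v ω ≤ ENNReal.ofReal (M j) * ENNReal.ofReal T := by
    intro j ω
    refine le_trans ?_ (mul_le_mul_right (totalTime_le (U := U) (ε := ε) (B := univ) (x := x)
      (v := v) (ω := ω) hT) _)
    unfold totalArea totalTime
    rw [← ENNReal.tsum_mul_left]
    refine ENNReal.tsum_le_tsum fun n => ?_
    by_cases ha : Active U ε univ T x v ω n
    · have hmem : ω ∈ {ω | Active U ε univ T x v ω n} := ha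
      rw [indicator_of_mem hmem, indicator_of_mem hmem]
      calc _ ≤ ∫⁻ s in Ioo 0 (activeLen U ε univ T x v ω n), ENNReal.ofReal (M j) := by
            refine setLIntegral_mono measurable_const fun s hs => ENNReal.ofReal_le_ofReal ?_
            refine (le_abs_self _).trans ?_
            rw [pathDrive, abs_drive (isSign_skeleton hv n)]
            refine hM j _ ((ha.dist_flight_le hv hs.1.le).trans ?_)
            gcongr
            linarith [ha.time_add_activeLen_le hT, hs.2]
        _ = _ := by simp
    · have hmem : ω ∉ {ω | Active U ε univ T x v ω n} := ha
      rw [indicator_of_notMem hmem]; exact zero_le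
  have hfin : ∀ j, ∀ᵐ ω ∂(clockMeasure N), ringCount U ε univ T j x v ω < ∞ := by
    intro j
    refine ae_lt_top (measurable_ringCount hU hε isClosed_univ) ?_
    rw [lintegral_ringCount hU hε isClosed_univ]
    refine ENNReal.mul_ne_top ENNReal.ofReal_ne_top (ne_of_lt ?_)
    calc _ ≤ ∫⁻ _, ENNReal.ofReal (M j) * ENNReal.ofReal T ∂(clockMeasure N) :=
          lintegral_mono (harea j)
      _ < ∞ := by simp [ENNReal.mul_lt_top_iff]
  filter_upwards [ae_all_iff.2 hfin] with ω hω
  by_contra! hall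
  -- Every flight ends with the ring of some coordinate, so infinitely many events before T would
  -- make one of finitely many ring counts infinite.
  have h1 : ∑' _ : ℕ, (1 : ℝ≥0∞) ≤ ∑ j, ringCount U ε univ T j x v ω := by
    unfold ringCount
    rw [← Summable.tsum_finsetSum fun j _ => ENNReal.summable]
    refine ENNReal.tsum_le_tsum fun n => ?_
    obtain ⟨j, hj⟩ := exists_rings (U := U) (ε := ε) (x := x) (v := v) (ω := ω) hN n
    refine le_trans (le_of_eq ?_) (Finset.single_le_sum (fun _ _ => zero_le) (Finset.mem_univ j))
    exact (indicator_of_mem (s := {ω | Active U ε univ T x v ω (n + 1) ∧ Rings U ε x v j ω n})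
      ⟨hall (n + 1), hj⟩ (fun _ => (1 : ℝ≥0∞))).symm
  rw [ENNReal.tsum_const_eq_top_of_ne_zero one_ne_zero, top_le_iff] at h1
  exact absurd h1 (ENNReal.sum_lt_top.2 fun j _ => hω j).ne

end Expectation

/-! ### From the event skeleton to the continuous-time path. -/

section Conversion

variable {U : EuclideanSpace ℝ (Fin N) → ℝ} {ε : ℝ} {i : Fin N}
  {B : Set (EuclideanSpace ℝ (Fin N))} {T : ℝ}
  {x v : EuclideanSpace ℝ (Fin N)} {ω : ℕ × Fin N → ℝ}

theorem flightTime_pos (hU : ∀ i, Continuous (pd U i)) (hε : 0 < ε) (hω : ∀ k, 0 < ω k)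
    (hN : Nonempty (Fin N)) (n : ℕ) : 0 < flightTime U ε x v ω n := by
  obtain ⟨j, hj⟩ := exists_rings (U := U) (ε := ε) (x := x) (v := v) (ω := ω) hN n
  rw [← hj]
  exact hitTime_pos (continuous_rate hU j _ _) (rate_nonneg hε j _ _) (hω _)

theorem skeleton_time_mono : Monotone fun n => (skeleton U ε x v ω n).1 :=
  monotone_nat_of_le_succ fun _ => le_self_add

theorem exitRay_univ : exitRay univ x v = ∞ := by simp [exitRay]

theorem active_univ_of_time_le {n : ℕ} (h : (skeleton U ε x v ω n).1 ≤ ENNReal.ofReal T) :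
    Active U ε univ T x v ω n := by
  induction n with
  | zero => trivial
  | succ n ih =>
    have h1 : (skeleton U ε x v ω n).1 ≤ ENNReal.ofReal T := (skeleton_time_mono n.le_succ).trans h
    refine ⟨ih h1, ?_⟩
    rw [horizon, exitRay_univ, min_eq_right le_top]
    exact ENNReal.le_sub_of_add_le_left (h1.trans_lt ENNReal.ofReal_lt_top).ne h

theorem exists_time_gt (hω : ∃ n, ¬ Active U ε univ T x v ω n) :
    ∃ n, ENNReal.ofReal T < (skeleton U ε x v ω n).1 := by
  obtain ⟨n, hn⟩ := hω
  exact ⟨n, not_le.1 fun h => hn (active_univ_of_time_le h)⟩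

/-- The strict inequality for the next event bounds the index set, so `sSup` is a true maximum and
not its default value 0. -/
theorem eventIndex_eq {n : ℕ} {t : ℝ} (h1 : (skeleton U ε x v ω n).1 ≤ ENNReal.ofReal t)
    (h2 : ENNReal.ofReal t < (skeleton U ε x v ω (n + 1)).1) :
    eventIndex U ε x v ω t = n := by
  have : {m | (skeleton U ε x v ω m).1 ≤ ENNReal.ofReal t} = Iic n := by
    ext m
    refine ⟨fun hm => ?_, fun hm => (skeleton_time_mono hm).trans h1⟩
    by_contra hlt
    rw [mem_Iic, not_le] at hlt
    exact absurd (hm : (skeleton U ε x v ω m).1 ≤ _)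
      (not_le.2 (h2.trans_le (skeleton_time_mono (Nat.succ_le_of_lt hlt))))
  rw [eventIndex, this, csSup_Iic]

theorem exists_flight (hω : ∃ n, ENNReal.ofReal T < (skeleton U ε x v ω n).1) {t : ℝ}
    (htT : t ≤ T) : ∃ n, (skeleton U ε x v ω n).1 ≤ ENNReal.ofReal t ∧
      ENNReal.ofReal t < (skeleton U ε x v ω (n + 1)).1 := by
  classical
  have hex : ∃ n, ENNReal.ofReal t < (skeleton U ε x v ω n).1 := by
    obtain ⟨n, hn⟩ := hω
    exact ⟨n, (ENNReal.ofReal_le_ofReal htT).trans_lt hn⟩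
  obtain ⟨k, hk⟩ : ∃ k, Nat.find hex = k + 1 := by
    refine Nat.exists_eq_succ_of_ne_zero fun h0 => ?_
    have := Nat.find_spec hex
    rw [h0] at this
    exact not_lt_zero this
  refine ⟨k, not_lt.1 (Nat.find_min hex (by omega)), ?_⟩
  rw [← hk]
  exact Nat.find_spec hex

theorem pos_eq {n : ℕ} {t : ℝ} (h1 : (skeleton U ε x v ω n).1 ≤ ENNReal.ofReal t)
    (h2 : ENNReal.ofReal t < (skeleton U ε x v ω (n + 1)).1) :
    pos U ε x v ω t = (skeleton U ε x v ω n).2.1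
      + (t - (skeleton U ε x v ω n).1.toReal) • (skeleton U ε x v ω n).2.2 := by
  rw [pos, eventIndex_eq h1 h2]

theorem vel_eq {n : ℕ} {t : ℝ} (h1 : (skeleton U ε x v ω n).1 ≤ ENNReal.ofReal t)
    (h2 : ENNReal.ofReal t < (skeleton U ε x v ω (n + 1)).1) :
    vel U ε x v ω t = (skeleton U ε x v ω n).2.2 := by
  rw [vel, eventIndex_eq h1 h2]

theorem leftLim_vel {n : ℕ} {s : ℝ} (h1 : (skeleton U ε x v ω n).1 < ENNReal.ofReal s)
    (h2 : ENNReal.ofReal s ≤ (skeleton U ε x v ω (n + 1)).1) :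
    Function.leftLim (fun t => vel U ε x v ω t i) s = (skeleton U ε x v ω n).2.2 i := by
  refine leftLim_eq_of_tendsto (tendsto_const_nhds.congr' ?_)
  have hs : (skeleton U ε x v ω n).1.toReal < s := by
    have := ENNReal.toReal_lt_of_lt_ofReal h1
    exact this
  filter_upwards [Ioo_mem_nhdsLT hs] with t ht
  rw [vel_eq (n := n)]
  · rw [← ENNReal.ofReal_toReal (h1.trans ENNReal.ofReal_lt_top).ne]
    exact ENNReal.ofReal_le_ofReal ht.1.le
  · exact ((ENNReal.ofReal_lt_ofReal_iff_of_nonneg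
      (ENNReal.toReal_nonneg.trans ht.1.le)).2 ht.2).trans_le h2

/-- The position at time `s` after the start of the `n`-th flight. -/
theorem pos_flight {n : ℕ} {s : ℝ} (hs : 0 ≤ s) (hn : (skeleton U ε x v ω n).1 ≠ ∞)
    (h : ENNReal.ofReal s < flightTime U ε x v ω n) :
    pos U ε x v ω ((skeleton U ε x v ω n).1.toReal + s)
      = (skeleton U ε x v ω n).2.1 + s • (skeleton U ε x v ω n).2.2 := by
  have h0 : ENNReal.ofReal ((skeleton U ε x v ω n).1.toReal + s)
      = (skeleton U ε x v ω n).1 + ENNReal.ofReal s := by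
    rw [ENNReal.ofReal_add ENNReal.toReal_nonneg hs, ENNReal.ofReal_toReal hn]
  rw [pos_eq (n := n), add_sub_cancel_left]
  · rw [h0]; exact le_self_add
  · rw [h0]
    exact ENNReal.add_lt_add_left hn h

variable {xs : EuclideanSpace ℝ (Fin N)} {γ : ℝ}

theorem pos_mem_of_mem_stoppedInterval {t : ℝ} (ht : t ∈ stoppedInterval U xs γ ε T x v ω) {s : ℝ}
    (hs : 0 ≤ s) (hst : s < t) : pos U ε x v ω s ∈ band U xs γ := by
  by_contra hn
  have h1 : exitTime U xs γ ε x v ω ≤ ENNReal.ofReal s :=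
    iInf₂_le (f := fun s _ => ENNReal.ofReal s) s ⟨hs, hn⟩
  exact absurd (ht.2.2.trans h1) (not_le.2 ((ENNReal.ofReal_lt_ofReal_iff_of_nonneg hs).2 hst))

/-- Before its end each flight coincides with its free ray, so a ray that left the band too early
would make the path leave it strictly before t. -/
theorem active_of_mem_stoppedInterval {t : ℝ} (ht : t ∈ stoppedInterval U xs γ ε T x v ω) {n : ℕ}
    (h1 : (skeleton U ε x v ω n).1 ≤ ENNReal.ofReal t)
    (h2 : ENNReal.ofReal t < (skeleton U ε x v ω (n + 1)).1) :
    Active U ε (band U xs γ) T x v ω n ∧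
      t - (skeleton U ε x v ω n).1.toReal ≤ activeLen U ε (band U xs γ) T x v ω n := by
  have hray : ∀ m ≤ n, ∀ l : ℝ≥0∞, l ≤ flightTime U ε x v ω m →
      (skeleton U ε x v ω m).1 + l ≤ ENNReal.ofReal t → l ≤
        horizon U ε (band U xs γ) T x v ω m := by
    intro m hm l hl hlt
    have hfin : (skeleton U ε x v ω m).1 ≠ ∞ :=
      (le_self_add.trans hlt).trans_lt ENNReal.ofReal_lt_top |>.ne
    refine le_min (le_iInf₂ fun s hs => ?_) (ENNReal.le_sub_of_add_le_left hfin
      (hlt.trans (ENNReal.ofReal_le_ofReal ht.2.1)))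
    by_contra! hsl
    have hpos := pos_flight hs.1 hfin (hsl.trans_le hl)
    refine hs.2 ?_
    rw [← hpos]
    refine pos_mem_of_mem_stoppedInterval ht (add_nonneg ENNReal.toReal_nonneg hs.1) ?_
    rw [← ENNReal.ofReal_lt_ofReal_iff_of_nonneg (add_nonneg ENNReal.toReal_nonneg hs.1),
      ENNReal.ofReal_add ENNReal.toReal_nonneg hs.1, ENNReal.ofReal_toReal hfin]
    exact (ENNReal.add_lt_add_left hfin hsl).trans_le hlt
  constructor
  · have : ∀ m ≤ n, Active U ε (band U xs γ) T x v ω m := by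
      intro m hm
      induction m with
      | zero => trivial
      | succ m ih =>
        exact ⟨ih (by omega), hray m (by omega) _ le_rfl ((skeleton_time_mono hm).trans h1)⟩
    exact this n le_rfl
  · have hfin : (skeleton U ε x v ω n).1 ≠ ∞ := (h1.trans_lt ENNReal.ofReal_lt_top).ne
    have hle : (skeleton U ε x v ω n).1.toReal ≤ t := by
      have := ENNReal.toReal_mono ENNReal.ofReal_ne_top h1
      rwa [ENNReal.toReal_ofReal ht.1] at this
    have hsum : (skeleton U ε x v ω n).1 +
        ENNReal.ofReal (t - (skeleton U ε x v ω n).1.toReal) = ENNReal.ofReal t := by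
      nth_rw 1 [← ENNReal.ofReal_toReal hfin]
      rw [← ENNReal.ofReal_add ENNReal.toReal_nonneg (by linarith), add_sub_cancel]
    have hfl : ENNReal.ofReal (t - (skeleton U ε x v ω n).1.toReal) ≤ flightTime U ε x v ω n := by
      by_contra! hlt
      have := ENNReal.add_lt_add_left hfin hlt
      rw [hsum] at this
      exact absurd (this.trans h2) (lt_irrefl _)
    rw [← ENNReal.ofReal_le_ofReal_iff (activeLen_nonneg n), ofReal_activeLen]
    exact le_min hfl (hray n le_rfl _ hfl hsum.le)

theorem ringCount_eq_encard : ringCount U ε B T i x v ω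
    = (Set.encard {n | Active U ε B T x v ω (n + 1) ∧ Rings U ε x v i ω n} : ℝ≥0∞) := by
  rw [← ENNReal.tsum_set_one, tsum_subtype _ fun _ => (1 : ℝ≥0∞)]
  rfl

theorem time_lt_succ (hpos : ∀ n, 0 < flightTime U ε x v ω n) {n : ℕ}
    (hn : (skeleton U ε x v ω n).1 ≠ ∞) :
    (skeleton U ε x v ω n).1 < (skeleton U ε x v ω (n + 1)).1 :=
  ENNReal.lt_add_right hn (hpos n).ne'

theorem flipCount_le_ringCount (hω : ∃ n, ENNReal.ofReal T < (skeleton U ε x v ω n).1)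
    (hpos : ∀ n, 0 < flightTime U ε x v ω n) :
    (flipCount U xs γ ε T i x v ω : ℝ≥0∞) ≤ ringCount U ε (band U xs γ) T i x v ω := by
  rw [ringCount_eq_encard]
  refine ENat.toENNReal_mono ?_
  refine le_trans (Set.encard_le_encard ?_) (Set.encard_image_le
    (fun n => (skeleton U ε x v ω (n + 1)).1.toReal) _)
  rintro s ⟨hs, hs0, hne⟩
  obtain ⟨n, h1, h2⟩ := exists_flight hω hs.2.1
  -- Strictly inside a flight the velocity equals its left limit. A flip time is therefore an event
  -- time, and not the zeroth one because s > 0.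
  rcases h1.eq_or_lt with heq | hlt
  · obtain ⟨m, rfl⟩ : ∃ m, n = m + 1 := by
      refine Nat.exists_eq_succ_of_ne_zero ?_
      rintro rfl
      change (0 : ℝ≥0∞) = _ at heq
      exact absurd heq.symm (by simpa using hs0)
    refine ⟨m, ⟨(active_of_mem_stoppedInterval hs h1 h2).1, ?_⟩, ?_⟩
    · by_contra hr
      rw [vel_eq h1 h2, (skeleton_succ_vel m i).2 hr] at hne
      have hl := time_lt_succ hpos (n := m)
        (((skeleton_time_mono m.le_succ).trans h1).trans_lt ENNReal.ofReal_lt_top).ne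
      exact hne (leftLim_vel (hl.trans_le heq.le) heq.ge).symm
    · simp only [heq, ENNReal.toReal_ofReal hs.1]
  · exact absurd (by rw [vel_eq h1 h2, leftLim_vel hlt h2.le]) hne

theorem supPartial_le (hω : ∃ n, ENNReal.ofReal T < (skeleton U ε x v ω n).1) (hv : IsSign v)
    {c : ℝ} (hc : ∀ n, Active U ε (band U xs γ) T x v ω n →
      ∀ s ∈ Icc 0 (activeLen U ε (band U xs γ) T x v ω n), |pathDrive U ε i x v ω n s| ≤ c) :
    supPartial U xs γ ε T i x v ω ≤ ENNReal.ofReal c := by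
  refine iSup₂_le fun t ht => ENNReal.ofReal_le_ofReal ?_
  obtain ⟨n, h1, h2⟩ := exists_flight hω ht.2.1
  obtain ⟨ha, hlen⟩ := active_of_mem_stoppedInterval ht h1 h2
  rw [pos_eq h1 h2, ← abs_drive (isSign_skeleton hv n)]
  refine hc n ha _ ⟨?_, hlen⟩
  have := ENNReal.toReal_mono ENNReal.ofReal_ne_top h1
  rw [ENNReal.toReal_ofReal ht.1] at this
  linarith

theorem dist_pos_le (hω : ∃ n, ENNReal.ofReal T < (skeleton U ε x v ω n).1) (hv : IsSign v)
    {t : ℝ} (ht : 0 ≤ t) (htT : t ≤ T) : ‖pos U ε x v ω t - x‖ ≤ √N * t := by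
  obtain ⟨n, h1, h2⟩ := exists_flight hω htT
  have hle := ENNReal.toReal_mono ENNReal.ofReal_ne_top h1
  rw [ENNReal.toReal_ofReal ht] at hle
  rw [pos_eq h1 h2]
  have := (active_univ_of_time_le h1).dist_flight_le hv
    (s := t - (skeleton U ε x v ω n).1.toReal) (by linarith)
  rwa [add_sub_cancel] at this

theorem le_exitTime (hω : ∃ n, ENNReal.ofReal T < (skeleton U ε x v ω n).1) (hv : IsSign v)
    (hball : ∀ y, ‖y - x‖ ≤ √N * T → y ∈ band U xs γ) :
    ENNReal.ofReal T ≤ exitTime U xs γ ε x v ω := by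
  refine le_iInf₂ fun t ht => ENNReal.ofReal_le_ofReal ?_
  by_contra! hlt
  refine ht.2 (hball _ ((dist_pos_le hω hv ht.1 hlt.le).trans ?_))
  gcongr

/-- Flights have positive length, so distinct events have distinct times and each ring is seen as a
jump from ±1 to ∓1. The reachable ball lies in the band, so none is lost to the exit. -/
theorem ringCount_le_flipCount {T' : ℝ} (hω : ∃ n, ENNReal.ofReal T < (skeleton U ε x v ω n).1)
    (hpos : ∀ n, 0 < flightTime U ε x v ω n) (hv : IsSign v) (hT0 : 0 ≤ T') (hT : T' ≤ T)
    (hball : ∀ y, ‖y - x‖ ≤ √N * T' → y ∈ band U xs γ) :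
    ringCount U ε B T' i x v ω ≤ (flipCount U xs γ ε T i x v ω : ℝ≥0∞) := by
  have hω' : ∃ n, ENNReal.ofReal T' < (skeleton U ε x v ω n).1 := by
    obtain ⟨n, hn⟩ := hω
    exact ⟨n, (ENNReal.ofReal_le_ofReal hT).trans_lt hn⟩
  rw [ringCount_eq_encard]
  refine ENat.toENNReal_mono (Set.encard_le_encard_of_injOn
    (f := fun n => (skeleton U ε x v ω (n + 1)).1.toReal) ?_ ?_)
  · rintro n ⟨ha, hr⟩
    have hfin := ha.time_ne_top
    have h2 := time_lt_succ hpos hfin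
    have h1 := time_lt_succ hpos ha.1.time_ne_top
    have hsT : (skeleton U ε x v ω (n + 1)).1.toReal ≤ T' := by
      have := ENNReal.toReal_mono ENNReal.ofReal_ne_top ha.time_le
      rwa [ENNReal.toReal_ofReal hT0] at this
    refine ⟨⟨ENNReal.toReal_nonneg, hsT.trans hT,
      (ENNReal.ofReal_le_ofReal hsT).trans (le_exitTime hω' hv hball)⟩,
      ENNReal.toReal_pos (bot_lt_of_lt h1).ne' hfin, ?_⟩
    have hof := ENNReal.ofReal_toReal hfin
    rw [vel_eq hof.ge (hof.trans_lt h2), leftLim_vel (h1.trans_le hof.ge) hof.le,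
      (skeleton_succ_vel n i).1 hr]
    rcases isSign_skeleton (U := U) (ε := ε) (x := x) (ω := ω) hv n i with h | h <;>
      rw [h] <;> norm_num
  · rintro n ⟨ha, -⟩ m ⟨hb, -⟩ heq
    have heq' := (ENNReal.toReal_eq_toReal_iff' ha.time_ne_top hb.time_ne_top).1 heq
    by_contra hne
    rcases Nat.lt_or_gt_of_ne hne with h | h
    · exact absurd heq' ((time_lt_succ hpos ha.time_ne_top).trans_le
        (skeleton_time_mono (by omega : n + 1 + 1 ≤ m + 1))).ne
    · exact absurd heq' ((time_lt_succ hpos hb.time_ne_top).trans_le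
        (skeleton_time_mono (by omega : m + 1 + 1 ≤ n + 1))).ne'

/-- If the ball that the process can reach is contained in `B`, some flight lasts until `T`. -/
theorem exists_last_flight (hω : ∃ n, ENNReal.ofReal T < (skeleton U ε x v ω n).1)
    (hv : IsSign v) (hT : 0 ≤ T) (hball : ∀ y, ‖y - x‖ ≤ √N * T → y ∈ B) :
    ∃ n, Active U ε B T x v ω n ∧
      (skeleton U ε x v ω n).1.toReal + activeLen U ε B T x v ω n = T := by
  classical
  have hex : ∃ n, ¬ Active U ε B T x v ω n := by
    obtain ⟨n, hn⟩ := hω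
    exact ⟨n, fun h => absurd h.time_le (not_le.2 hn)⟩
  obtain ⟨k, hk⟩ : ∃ k, Nat.find hex = k + 1 := by
    refine Nat.exists_eq_succ_of_ne_zero fun h0 => ?_
    have := Nat.find_spec hex
    rw [h0] at this
    exact this trivial
  have hact : Active U ε B T x v ω k := not_not.1 (Nat.find_min hex (by omega))
  have hnot := Nat.find_spec hex
  rw [hk] at hnot
  have hlt : horizon U ε B T x v ω k < flightTime U ε x v ω k :=
    not_le.1 fun h => hnot ⟨hact, h⟩
  -- The ray cannot leave B before T, since its points stay in the ball of radius √N T; what stops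
  -- flight k is the clock time T alone.
  have hray : ENNReal.ofReal T - (skeleton U ε x v ω k).1 ≤
      exitRay B (skeleton U ε x v ω k).2.1 (skeleton U ε x v ω k).2.2 := by
    refine le_iInf₂ fun s hs => ?_
    by_contra! hlt
    refine hs.2 (hball _ ((hact.dist_flight_le hv hs.1).trans ?_))
    gcongr
    have h1 : (skeleton U ε x v ω k).1 + ENNReal.ofReal s ≤ ENNReal.ofReal T := by
      have := add_le_add_right hlt.le (skeleton U ε x v ω k).1
      rwa [add_tsub_cancel_of_le hact.time_le] at this
    have h2 := ENNReal.toReal_mono ENNReal.ofReal_ne_top h1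
    rwa [ENNReal.toReal_add hact.time_ne_top ENNReal.ofReal_ne_top, ENNReal.toReal_ofReal hT,
      ENNReal.toReal_ofReal hs.1] at h2
  refine ⟨k, hact, ?_⟩
  rw [activeLen, min_eq_right hlt.le, horizon, min_eq_right hray,
    ENNReal.toReal_sub_of_le hact.time_le ENNReal.ofReal_ne_top, ENNReal.toReal_ofReal hT]
  ring

end Conversion

/-! ### Bounds on the expectations. -/

section Bounds

variable {U : EuclideanSpace ℝ (Fin N) → ℝ} {ε : ℝ} {i : Fin N}
  {B : Set (EuclideanSpace ℝ (Fin N))} {T : ℝ} {K M η δ : ℝ}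
  {x v xs : EuclideanSpace ℝ (Fin N)} {ω : ℕ × Fin N → ℝ} {γ : ℝ}

/-- The bound on the signed derivative in terms of its total area. -/
theorem Active.pathDrive_le_area (hC : Controlled U i B K M η δ) (hU : ∀ i, Continuous (pd U i))
    (hε : 0 < ε) (hω : ∀ k, 0 < ω k) (hv : IsSign v) (hx : x ∈ B) (hxi : pd U i x = 0)
    (hfin : totalArea U ε B T i x v ω ≠ ∞) {r : ℝ} (hr : 0 < r)
    {n : ℕ} (h : Active U ε B T x v ω n) {s : ℝ} (hs : s ∈ Icc 0 (activeLen U ε B T x v ω n)) :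
    pathDrive U ε i x v ω n s ≤ r / 2 + K / r * (totalArea U ε B T i x v ω).toReal := by
  have hK := hC.K_pos
  set A := (totalArea U ε B T i x v ω).toReal with hA
  have hA0 : 0 ≤ A := ENNReal.toReal_nonneg
  refine h.pathDrive_le hC hU hε hω hv hx hxi (by positivity) (fun n hn => ?_) hs
  have h1 := sum_posArea_le hU hfin hn
  -- The square root √(2KA) is replaced by r/2 + KA/r, which is linear in A and so can be integrated
  -- using E[A] alone.
  have h2 : (r / 2 + K / r * A) ^ 2 = 2 * K * A + (r / 2 - K / r * A) ^ 2 := by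
    field_simp; ring
  have h3 := mul_le_mul_of_nonneg_left h1 (by positivity : 0 ≤ 2 * K)
  linarith [sq_nonneg (r / 2 - K / r * A)]

theorem ofReal_width (hK : 0 < K) {r : ℝ} (hr : 0 < r) {A : ℝ≥0∞} (hA : A ≠ ∞) :
    ENNReal.ofReal (r / 2 + K / r * A.toReal)
      = ENNReal.ofReal (r / 2) + ENNReal.ofReal (K / r) * A := by
  rw [ENNReal.ofReal_add (by positivity) (by positivity), ENNReal.ofReal_mul (by positivity),
    ENNReal.ofReal_toReal hA]

theorem ae_totalArea_lt_top (hC : Controlled U i B K M η δ) (hU : ∀ i, Continuous (pd U i))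
    (hε : 0 < ε) (hv : IsSign v) (hx : x ∈ B) (hxi : pd U i x = 0) (hT : 0 ≤ T) :
    ∀ᵐ ω ∂(clockMeasure N), totalArea U ε B T i x v ω < ∞ := by
  refine ae_lt_top (measurable_totalArea hU hε hC.isClosed) ?_
  exact ((lintegral_totalArea_le hC hU hv hx hxi hT (Real.sqrt_pos.2 hε)
    (Real.sq_sqrt hε.le)).trans_lt ENNReal.ofReal_lt_top).ne

theorem lintegral_flipCount_le (hC : Controlled U i (band U xs γ) K M η δ)
    (hU : ∀ i, Continuous (pd U i)) (hv : IsSign v) (hx : x ∈ band U xs γ) (hxi : pd U i x = 0)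
    (hT : 0 ≤ T) {r : ℝ} (hr : 0 < r) (hrε : r ^ 2 = ε) :
    ∫⁻ ω, (flipCount U xs γ ε T i x v ω : ℝ≥0∞) ∂(clockMeasure N)
      ≤ ENNReal.ofReal ((T + (M + K * T) / 2) / 2 * r⁻¹) := by
  have hε : 0 < ε := hrε ▸ by positivity
  calc _ ≤ ∫⁻ ω, ringCount U ε (band U xs γ) T i x v ω ∂(clockMeasure N) := by
        refine lintegral_mono_ae ?_
        filter_upwards [ae_clock_pos, ae_exists_not_active hU hε hv ⟨i⟩ hT] with ω hω hfin
        exact flipCount_le_ringCount (exists_time_gt hfin) (flightTime_pos hU hε hω ⟨i⟩)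
    _ ≤ ENNReal.ofReal ε⁻¹ * ENNReal.ofReal (r / 2 * (T + (M + K * T) / 2)) := by
        rw [lintegral_ringCount hU hε hC.isClosed]
        gcongr
        exact lintegral_totalArea_le hC hU hv hx hxi hT hr hrε
    _ = _ := by
        rw [← ENNReal.ofReal_mul (by positivity)]
        congr 1
        subst hrε
        field_simp

/-- Here r = ε^(1/4): the expected area has order r², so both terms of r/2 + KA/r have expectation
of order r. -/
theorem lintegral_supPartial_le (hC : Controlled U i (band U xs γ) K M η δ)
    (hU : ∀ i, Continuous (pd U i)) (hv : IsSign v) (hx : x ∈ band U xs γ) (hxi : pd U i x = 0)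
    (hT : 0 ≤ T) {r : ℝ} (hr : 0 < r) (hrε : r ^ 4 = ε) :
    ∫⁻ ω, supPartial U xs γ ε T i x v ω ∂(clockMeasure N)
      ≤ ENNReal.ofReal ((1 + M / η) * (1 / 2 + K * ((T + (M + K * T) / 2) / 2)) * r) := by
  have hε : 0 < ε := hrε ▸ by positivity
  have hK := hC.K_pos
  have hM := hC.M_nonneg
  have hη := hC.η_pos
  have hmA := measurable_totalArea (T := T) (i := i) (x := x) (v := v) hU hε hC.isClosed
  calc _ ≤ ∫⁻ ω, ENNReal.ofReal (1 + M / η) * (ENNReal.ofReal (r / 2) +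
        ENNReal.ofReal (K / r) * totalArea U ε (band U xs γ) T i x v ω) ∂(clockMeasure N) := by
        refine lintegral_mono_ae ?_
        filter_upwards [ae_clock_pos, ae_exists_not_active hU hε hv ⟨i⟩ hT,
          ae_totalArea_lt_top hC hU hε hv hx hxi hT] with ω hω hfin hA
        rw [← ofReal_width hK hr hA.ne, ← ENNReal.ofReal_mul (by positivity)]
        refine supPartial_le (exists_time_gt hfin) hv fun n hn s hs => ?_
        refine hn.abs_pathDrive_le hC hv hx hxi (by positivity) (fun m hm s hs => ?_) hs
        exact hm.pathDrive_le_area hC hU hε hω hv hx hxi hA.ne hr hs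
    _ = ENNReal.ofReal (1 + M / η) * (ENNReal.ofReal (r / 2) + ENNReal.ofReal (K / r) *
          ∫⁻ ω, totalArea U ε (band U xs γ) T i x v ω ∂(clockMeasure N)) := by
        rw [lintegral_const_mul' _ _ ENNReal.ofReal_ne_top,
          lintegral_add_left measurable_const, lintegral_const_mul _ hmA]
        simp
    _ ≤ ENNReal.ofReal (1 + M / η) * (ENNReal.ofReal (r / 2) + ENNReal.ofReal (K / r) *
          ENNReal.ofReal (r ^ 2 / 2 * (T + (M + K * T) / 2))) := by
        gcongr
        exact lintegral_totalArea_le hC hU hv hx hxi hT (by positivity) (by rw [← hrε]; ring)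
    _ = _ := by
        rw [← ENNReal.ofReal_mul (by positivity), ← ENNReal.ofReal_add (by positivity)
          (by positivity), ← ENNReal.ofReal_mul (by positivity)]
        congr 1
        field_simp

theorem ofReal_jumpSum_zero_le {n : ℕ} (h : Active U ε B T x v ω n) :
    ENNReal.ofReal (jumpSum U ε i x v ω 0 n) ≤ ringCount U ε B T i x v ω := by
  rw [jumpSum, ENNReal.ofReal_sum_of_nonneg fun m _ => by split_ifs <;> simp]
  refine le_trans (Finset.sum_le_sum fun m hm => ?_) (ENNReal.sum_le_tsum (Finset.range n))
  split_ifs with hr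
  · rw [pow_zero, ENNReal.ofReal_one]
    exact (indicator_of_mem (s := {ω | Active U ε B T x v ω (m + 1) ∧ Rings U ε x v i ω m})
      ⟨h.of_le (Finset.mem_range.1 hm), hr⟩ (fun _ => (1 : ℝ≥0∞))).ge
  · rw [ENNReal.ofReal_zero]; exact zero_le

/-- Termwise 2z ≤ l + z²/l; this trades the sum of heights for the number of rings and the sum of
squares. -/
theorem two_mul_jumpSum_one_le {l : ℝ} (hl : 0 < l) (n : ℕ) :
    2 * jumpSum U ε i x v ω 1 n
      ≤ l * jumpSum U ε i x v ω 0 n + l⁻¹ * jumpSum U ε i x v ω 2 n := by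
  simp only [jumpSum, Finset.mul_sum, ← Finset.sum_add_distrib]
  refine Finset.sum_le_sum fun m _ => ?_
  split_ifs
  · set z := pathDrive U ε i x v ω m (flightTime U ε x v ω m).toReal
    have : l * z ^ 0 + l⁻¹ * z ^ 2 - 2 * z ^ 1 = l⁻¹ * (l - z) ^ 2 := by field_simp; ring
    have h2 : 0 ≤ l⁻¹ * (l - z) ^ 2 := by positivity
    linarith
  · simp

/-- If the process stays in `B` up to time `T`, then there have to be many ringings. -/
theorem ofReal_le_ringCount (hC : Controlled U i B K M η δ) (hU : ∀ i, Continuous (pd U i))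
    (hε : 0 < ε) (hω : ∀ k, 0 < ω k) (hv : IsSign v) (hx : x ∈ B) (hxi : pd U i x = 0)
    (hT : 0 ≤ T) (hT' : ∃ n, ENNReal.ofReal T < (skeleton U ε x v ω n).1)
    (hball : ∀ y, ‖y - x‖ ≤ √N * T → y ∈ B)
    (hfin : totalArea U ε B T i x v ω ≠ ∞) {r l : ℝ} (hr : 0 < r) (hl : 0 < l) :
    ENNReal.ofReal (δ * T) ≤ ENNReal.ofReal l * ringCount U ε B T i x v ω
      + ENNReal.ofReal (2 * K / l + (1 + δ * T / η) * (K / r)) * totalArea U ε B T i x v ω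
      + ENNReal.ofReal ((1 + δ * T / η) * (r / 2)) := by
  have hK := hC.K_pos
  have hη := hC.η_pos
  have hδ := hC.δ_pos
  obtain ⟨n, hn, hlast⟩ := exists_last_flight hT' hv hT hball
  set A := (totalArea U ε B T i x v ω).toReal with hA
  have hA0 : 0 ≤ A := ENNReal.toReal_nonneg
  have h1 := hn.le_jumpSum hC hU hε hω hv hx hxi (w := r / 2 + K / r * A) (by positivity)
    (fun m hm s hs => hm.pathDrive_le_area hC hU hε hω hv hx hxi hfin hr hs) hT hlast
  have h2 := two_mul_jumpSum_one_le (U := U) (ε := ε) (i := i) (x := x) (v := v) (ω := ω) hl n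
  have h3 : jumpSum U ε i x v ω 2 n ≤ 2 * K * A := by
    have h := hn.jumpSum_two_le hC hU hε hω hv hx
    have h4 : pathDrive U ε i x v ω 0 0 = 0 := by simp [pathDrive, drive, skeleton, hxi]
    have h5 := sum_posArea_le hU hfin hn
    rw [Finset.sum_range_succ] at h5
    have h6 := posArea_nonneg (U := U) (ε := ε) (B := B) (T := T) (i := i) (x := x) (v := v)
      (ω := ω) n
    have h7 : ∑ m ∈ Finset.range n, posArea U ε B T i x v ω m ≤ A := by linarith
    rw [h4, max_self] at h
    have h8 := mul_le_mul_of_nonneg_left h7 (by positivity : 0 ≤ 2 * K)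
    linarith [sq_nonneg (max (pathDrive U ε i x v ω n 0) 0)]
  have h4 := mul_le_mul_of_nonneg_left h3 (inv_nonneg.2 hl.le)
  have hJ0 := jumpSum_nonneg (i := i) 0 hU hε hω hn
  calc ENNReal.ofReal (δ * T) ≤ ENNReal.ofReal (l * jumpSum U ε i x v ω 0 n
        + (2 * K / l + (1 + δ * T / η) * (K / r)) * A + (1 + δ * T / η) * (r / 2)) := by
        refine ENNReal.ofReal_le_ofReal ?_
        have : (2 * K / l + (1 + δ * T / η) * (K / r)) * A + (1 + δ * T / η) * (r / 2)
          = l⁻¹ * (2 * K * A) + (1 + δ * T / η) * (r / 2 + K / r * A) := by ring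
        linarith
    _ = ENNReal.ofReal l * ENNReal.ofReal (jumpSum U ε i x v ω 0 n)
      + ENNReal.ofReal (2 * K / l + (1 + δ * T / η) * (K / r)) * totalArea U ε B T i x v ω
      + ENNReal.ofReal ((1 + δ * T / η) * (r / 2)) := by
        rw [ENNReal.ofReal_add (by positivity) (by positivity),
          ENNReal.ofReal_add (by positivity) (by positivity), ENNReal.ofReal_mul hl.le,
          ENNReal.ofReal_mul (p := 2 * K / l + (1 + δ * T / η) * (K / r)) (by positivity), hA,
          ENNReal.ofReal_toReal hfin]
    _ ≤ _ := by
        gcongr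
        exact ofReal_jumpSum_zero_le hn

/-- T is a short time during which the band cannot be left, and T₀ is the actual horizon; flips
before T already suffice. -/
theorem le_lintegral_flipCount {T₀ : ℝ} (hC : Controlled U i (band U xs γ) K M η δ)
    (hU : ∀ i, Continuous (pd U i)) (hv : IsSign v) (hx : x ∈ band U xs γ) (hxi : pd U i x = 0)
    (hT : 0 < T) (hTT : T ≤ T₀) (hball : ∀ y, ‖y - x‖ ≤ √N * T → y ∈ band U xs γ)
    {r : ℝ} (hr : 0 < r) (hrε : r ^ 4 = ε)
    (hsmall : (1 + δ * T / η) * (K * ((T + (M + K * T) / 2) / 2) + 1 / 2) * r ≤ δ * T / 4) :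
    ENNReal.ofReal ((δ * T) ^ 2 / (16 * (K * ((T + (M + K * T) / 2) / 2))) * (r ^ 2)⁻¹)
      ≤ ∫⁻ ω, (flipCount U xs γ ε T₀ i x v ω : ℝ≥0∞) ∂(clockMeasure N) := by
  have hε : 0 < ε := hrε ▸ by positivity
  have hK := hC.K_pos
  have hM := hC.M_nonneg
  have hη := hC.η_pos
  have hδ := hC.δ_pos
  have hT₀ : 0 ≤ T₀ := hT.le.trans hTT
  set C₁ := (T + (M + K * T) / 2) / 2 with hC₁
  have hC₁0 : 0 < C₁ := by positivity
  -- As E[A] ≤ C₁ r², this l makes the term (2K/l) E[A] at most δT/4. The hypothesis `hsmall` makes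
  -- the remaining error another quarter, which leaves δT/2 for l times the number of rings.
  set l := 8 * K * C₁ / (δ * T) * r ^ 2 with hl
  have hl0 : 0 < l := by positivity
  have hmA := measurable_totalArea (T := T) (i := i) (x := x) (v := v) hU hε hC.isClosed
  have hmR := measurable_ringCount (T := T) (i := i) (x := x) (v := v) hU hε hC.isClosed
  set E := ∫⁻ ω, ringCount U ε (band U xs γ) T i x v ω ∂(clockMeasure N) with hE
  have hEle : E ≤ ∫⁻ ω, (flipCount U xs γ ε T₀ i x v ω : ℝ≥0∞) ∂(clockMeasure N) := by
    refine lintegral_mono_ae ?_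
    filter_upwards [ae_clock_pos, ae_exists_not_active hU hε hv ⟨i⟩ hT₀] with ω hω hfin
    exact ringCount_le_flipCount (exists_time_gt hfin) (flightTime_pos hU hε hω ⟨i⟩) hv hT.le hTT
      hball
  refine le_trans ?_ hEle
  have hmain : ENNReal.ofReal (δ * T) ≤ ENNReal.ofReal l * E + ENNReal.ofReal (δ * T / 2) := by
    calc ENNReal.ofReal (δ * T) = ∫⁻ _, ENNReal.ofReal (δ * T) ∂(clockMeasure N) := by simp
      _ ≤ ∫⁻ ω, (ENNReal.ofReal l * ringCount U ε (band U xs γ) T i x v ω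
          + ENNReal.ofReal (2 * K / l + (1 + δ * T / η) * (K / r)) *
            totalArea U ε (band U xs γ) T i x v ω
          + ENNReal.ofReal ((1 + δ * T / η) * (r / 2))) ∂(clockMeasure N) := by
          refine lintegral_mono_ae ?_
          filter_upwards [ae_clock_pos, ae_exists_not_active hU hε hv ⟨i⟩ hT.le,
            ae_totalArea_lt_top hC hU hε hv hx hxi hT.le] with ω hω hfin hA
          exact ofReal_le_ringCount hC hU hε hω hv hx hxi hT.le (exists_time_gt hfin) hball hA.ne
            hr hl0
      _ = ENNReal.ofReal l * E + ENNReal.ofReal (2 * K / l + (1 + δ * T / η) * (K / r)) *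
            ∫⁻ ω, totalArea U ε (band U xs γ) T i x v ω ∂(clockMeasure N)
          + ENNReal.ofReal ((1 + δ * T / η) * (r / 2)) := by
          rw [lintegral_add_right _ measurable_const, lintegral_add_left (hmR.const_mul _),
            lintegral_const_mul _ hmR, lintegral_const_mul _ hmA]
          simp [hE]
      _ ≤ ENNReal.ofReal l * E + ENNReal.ofReal (2 * K / l + (1 + δ * T / η) * (K / r)) *
            ENNReal.ofReal (r ^ 2 / 2 * (T + (M + K * T) / 2))
          + ENNReal.ofReal ((1 + δ * T / η) * (r / 2)) := by
          gcongr
          exact lintegral_totalArea_le hC hU hv hx hxi hT.le (by positivity) (by rw [← hrε]; ring)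
      _ ≤ ENNReal.ofReal l * E + ENNReal.ofReal (δ * T / 2) := by
          rw [← ENNReal.ofReal_mul (by positivity), add_assoc,
            ← ENNReal.ofReal_add (by positivity) (by positivity)]
          gcongr
          have h1 : 2 * K / l * (r ^ 2 / 2 * (T + (M + K * T) / 2)) = δ * T / 4 := by
            rw [show r ^ 2 / 2 * (T + (M + K * T) / 2) = r ^ 2 * C₁ by rw [hC₁]; ring, hl]
            field_simp; ring
          have h2 : (1 + δ * T / η) * (K / r) * (r ^ 2 / 2 * (T + (M + K * T) / 2))
              + (1 + δ * T / η) * (r / 2) = (1 + δ * T / η) * (K * C₁ + 1 / 2) * r := by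
            rw [show r ^ 2 / 2 * (T + (M + K * T) / 2) = r ^ 2 * C₁ by rw [hC₁]; ring]
            field_simp
          rw [add_mul]
          linarith
  have hhalf : ENNReal.ofReal (δ * T / 2) ≤ ENNReal.ofReal l * E := by
    have : ENNReal.ofReal (δ * T) = ENNReal.ofReal (δ * T / 2) + ENNReal.ofReal (δ * T / 2) := by
      rw [← ENNReal.ofReal_add (by positivity) (by positivity), add_halves]
    rw [this] at hmain
    exact (ENNReal.add_le_add_iff_right ENNReal.ofReal_ne_top).1 hmain
  calc _ = ENNReal.ofReal l⁻¹ * ENNReal.ofReal (δ * T / 2) := by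
        rw [← ENNReal.ofReal_mul (by positivity)]
        congr 1
        rw [hl]
        field_simp
        ring
    _ ≤ ENNReal.ofReal l⁻¹ * (ENNReal.ofReal l * E) := by gcongr
    _ = E := by
        rw [← mul_assoc, ← ENNReal.ofReal_mul (by positivity), inv_mul_cancel₀ hl0.ne',
          ENNReal.ofReal_one, one_mul]

end Bounds

/-! ### Verifying the slope bounds and the confinement time for a potential. -/

section Potential

variable {U : EuclideanSpace ℝ (Fin N) → ℝ} {xs : EuclideanSpace ℝ (Fin N)} {γ : ℝ}

theorem IsPotential.continuous_pd (hU : IsPotential U xs) (i : Fin N) : Continuous (pd U i) :=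
  (hU.contDiff_one.continuous_fderiv one_ne_zero).clm_apply continuous_const

theorem IsPotential.contDiffOn_pd (hU : IsPotential U xs) (i : Fin N) :
    ContDiffOn ℝ 2 (pd U i) {xs}ᶜ :=
  (hU.contDiffOn_three.fderiv_of_isOpen isOpen_compl_singleton (by norm_num)).clm_apply
    contDiffOn_const

theorem IsPotential.continuousOn_hess (hU : IsPotential U xs) (i j : Fin N) :
    ContinuousOn (fun x => hess U x i j) {xs}ᶜ :=
  ((hU.contDiffOn_pd i).continuousOn_fderiv_of_isOpen isOpen_compl_singleton
    (by norm_num)).clm_apply continuousOn_const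

theorem IsPotential.hasDerivAt_pd (hU : IsPotential U xs) (i : Fin N)
    {y : EuclideanSpace ℝ (Fin N)} (hy : y ≠ xs) (v : EuclideanSpace ℝ (Fin N)) :
    HasDerivAt (fun s : ℝ => pd U i (y + s • v)) (∑ j, v j * hess U y i j) 0 := by
  have hd : DifferentiableAt ℝ (pd U i) y :=
    ((hU.contDiffOn_pd i).contDiffAt (isOpen_compl_singleton.mem_nhds hy)).differentiableAt
      (by norm_num)
  have hsum : fderiv ℝ (pd U i) y v = ∑ j, v j * hess U y i j := by
    have hv : v = ∑ j, v j • EuclideanSpace.single j (1 : ℝ) := by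
      ext k
      simp [Finset.sum_apply, Pi.single_apply]
    conv_lhs => rw [hv]
    rw [map_sum]
    refine Finset.sum_congr rfl fun j _ => ?_
    rw [map_smul, smul_eq_mul]
    rfl
  rw [← hsum]
  have hline : HasDerivAt (fun s : ℝ => y + s • v) v 0 := by
    simpa using ((hasDerivAt_id (0 : ℝ)).smul_const v).const_add y
  have hd' : HasFDerivAt (pd U i) (fderiv ℝ (pd U i) y) (y + (0 : ℝ) • v) := by
    simpa using hd.hasFDerivAt
  exact hd'.comp_hasDerivAt 0 hline

theorem IsPotential.isClosed_band (hU : IsPotential U xs) : IsClosed (band U xs γ) :=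
  (isClosed_le continuous_const hU.contDiff_one.continuous).inter
    (isClosed_le hU.contDiff_one.continuous continuous_const)

theorem IsPotential.isCompact_sublevel (hU : IsPotential U xs) (c : ℝ) :
    IsCompact {y | U y ≤ c} := by
  have h := hU.coercive.eventually (eventually_gt_atTop c)
  obtain ⟨t, ht, hsub⟩ := mem_cocompact.1 h
  refine ht.of_isClosed_subset (isClosed_le hU.contDiff_one.continuous continuous_const)
    fun y hy => ?_
  by_contra hn
  have hlt : c < U y := hsub hn
  exact absurd hy (not_le.2 hlt)

theorem IsPotential.isCompact_band (hU : IsPotential U xs) : IsCompact (band U xs γ) :=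
  (hU.isCompact_sublevel (U xs + γ⁻¹)).of_isClosed_subset hU.isClosed_band fun _ hy => hy.2

theorem ne_of_mem_band (hγ : 0 < γ) {y : EuclideanSpace ℝ (Fin N)} (hy : y ∈ band U xs γ) :
    y ≠ xs := by
  rintro rfl
  linarith [hy.1]

/-- The slope of vᵢ ∂ᵢU along v is the diagonal Hessian entry plus off-diagonal entries with signs
±1, hence at least the dominance gap. Dominance is assumed only where ∂ᵢU vanishes; compactness
extends it to where ∂ᵢU is small. -/
theorem IsPotential.exists_controlled (hU : IsPotential U xs) (hDD : DiagDominant U xs)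
    (hγ : 0 < γ) (i : Fin N) : ∃ K M η δ, Controlled U i (band U xs γ) K M η δ := by
  have hsub : band U xs γ ⊆ {xs}ᶜ := fun y hy => ne_of_mem_band hγ hy
  have hh : ∀ j, ContinuousOn (fun y => hess U y i j) (band U xs γ) := fun j =>
    (hU.continuousOn_hess i j).mono hsub
  obtain ⟨M, hM⟩ := hU.isCompact_band.exists_bound_of_continuousOn (f := pd U i)
    (hU.continuous_pd i).continuousOn
  obtain ⟨K, hK⟩ := hU.isCompact_band.exists_bound_of_continuousOn
    (f := fun y => ∑ j, |hess U y i j|) (continuousOn_finsetSum _ fun j _ => (hh j).abs)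
  -- At every point of the band either ∂ᵢU ≠ 0 or the gap is positive, so the maximum of the two has
  -- a positive lower bound m. With η = m/2, the condition |∂ᵢU| ≤ η forces the gap to be at least
  -- m.
  obtain ⟨m, hm0, hm⟩ := hU.isCompact_band.exists_forall_le' (a := (0 : ℝ))
    (f := fun y => max |pd U i y| (hess U y i i - ∑ j ∈ Finset.univ.erase i, |hess U y i j|))
    ((hU.continuous_pd i).abs.continuousOn.sup ((hh i).sub
      (continuousOn_finsetSum _ fun j _ => (hh j).abs))) (fun y hy => by
      rw [lt_max_iff]
      by_cases h0 : pd U i y = 0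
      · exact Or.inr (hDD y (ne_of_mem_band hγ hy) i h0)
      · exact Or.inl (abs_pos.2 h0))
  refine ⟨max K 1, max M 0, m / 2, m / 2, hU.isClosed_band, lt_max_of_lt_right one_pos,
    le_max_right _ _, by positivity, by positivity, fun y hy => (hM y hy).trans (le_max_left _ _),
    fun y hy v hv => ⟨v i * ∑ j, v j * hess U y i j,
      (hU.hasDerivAt_pd i (ne_of_mem_band hγ hy) v).const_mul (v i), ?_, fun hsm => ?_⟩⟩
  · have habs : ∀ j, |v j| = 1 := fun j => by rcases hv j with h | h <;> simp [h]
    refine ((le_abs_self _).trans ?_).trans (((le_abs_self _).trans (hK y hy)).trans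
      (le_max_left _ _))
    rw [abs_mul, habs, one_mul]
    refine (Finset.abs_sum_le_sum_abs _ _).trans (le_of_eq (Finset.sum_congr rfl fun j _ => ?_))
    rw [abs_mul, habs, one_mul]
  · have hD : m ≤ hess U y i i - ∑ j ∈ Finset.univ.erase i, |hess U y i j| := by
      rcases le_max_iff.1 (hm y hy) with h | h
      · linarith
      · exact h
    have hvi : v i * v i = 1 := by rcases hv i with h | h <;> simp [h]
    have habs : ∀ j, |v i * v j| = 1 := fun j => by
      rcases hv i with h | h <;> rcases hv j with h' | h' <;> simp [h, h']
    rw [← Finset.add_sum_erase _ _ (Finset.mem_univ i), mul_add, ← mul_assoc, hvi, one_mul,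
      Finset.mul_sum]
    have : -∑ j ∈ Finset.univ.erase i, |hess U y i j|
        ≤ ∑ j ∈ Finset.univ.erase i, v i * (v j * hess U y i j) := by
      rw [← Finset.sum_neg_distrib]
      refine Finset.sum_le_sum fun j _ => ?_
      rw [← mul_assoc, neg_le]
      refine (neg_le_abs _).trans (le_of_eq ?_)
      rw [abs_mul, habs, one_mul]
    linarith

/-- A uniform time during which the process does not leave the band. -/
theorem IsPotential.exists_time (hU : IsPotential U xs) {a b : ℝ} (ha : U xs + γ < a)
    (hb : b < U xs + γ⁻¹) {T : ℝ} (hT : 0 < T) :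
    ∃ T', 0 < T' ∧ T' ≤ T ∧ ∀ x, a ≤ U x → U x ≤ b →
      ∀ y, ‖y - x‖ ≤ √N * T' → y ∈ band U xs γ := by
  have hc := hU.contDiff_one.continuous
  have hK : IsCompact {y | a ≤ U y ∧ U y ≤ b} :=
    (hU.isCompact_sublevel b).of_isClosed_subset
      ((isClosed_le continuous_const hc).inter (isClosed_le hc continuous_const)) fun _ hy => hy.2
  have hO : IsOpen {y | U xs + γ < U y ∧ U y < U xs + γ⁻¹} :=
    (isOpen_lt continuous_const hc).inter (isOpen_lt hc continuous_const)
  obtain ⟨ρ, hρ, hsub⟩ := hK.exists_cthickening_subset_open hO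
    fun y hy => ⟨ha.trans_le hy.1, hy.2.trans_lt hb⟩
  -- The speed is √N; adding 1 only keeps the denominator positive.
  have hN : 0 < √(N : ℝ) + 1 := by positivity
  refine ⟨min T (ρ / (√N + 1)), by positivity, min_le_left _ _, fun x hxa hxb y hy => ?_⟩
  have hyx : dist y x ≤ ρ := by
    rw [dist_eq_norm]
    have h1 : (min T (ρ / (√N + 1))) * (√N + 1) ≤ ρ := by
      rw [← le_div_iff₀ hN]; exact min_le_right _ _
    have h2 : 0 ≤ min T (ρ / (√N + 1)) := by positivity
    linarith
  have := hsub (Metric.mem_cthickening_of_dist_le y x ρ _ ⟨hxa, hxb⟩ hyx)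
  exact ⟨this.1.le, this.2.le⟩

end Potential

end ZigZag

end

/-! ### Choice of constants. -/

theorem mainTheorem6 {N : ℕ} (U : EuclideanSpace ℝ (Fin N) → ℝ) (xs : EuclideanSpace ℝ (Fin N))
    (hU : ZigZag.IsPotential U xs) (hDD : ZigZag.DiagDominant U xs)
    (γ : ℝ) (hγ0 : 0 < γ) (hγ1 : γ < 1) (T : ℝ) (hT : 0 < T) (i : Fin N) :
    ∃ C : ℝ, 0 < C ∧
      -- upper bounds, uniform over the open band
      (∃ ε₀ : ℝ, 0 < ε₀ ∧ ∀ ε : ℝ, 0 < ε → ε < ε₀ →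
        ∀ x : EuclideanSpace ℝ (Fin N), ZigZag.pd U i x = 0 →
          U xs + γ < U x → U x < U xs + γ⁻¹ →
        ∀ v : EuclideanSpace ℝ (Fin N), (∀ j, v j = 1 ∨ v j = -1) →
          (∫⁻ ω, (ZigZag.flipCount U xs γ ε T i x v ω : ℝ≥0∞) ∂(ZigZag.clockMeasure N)
            ≤ ENNReal.ofReal (C * ε ^ (-(1 / 2) : ℝ))) ∧
          (∫⁻ ω, ZigZag.supPartial U xs γ ε T i x v ω ∂(ZigZag.clockMeasure N)
            ≤ ENNReal.ofReal (C * ε ^ (1 / 4 : ℝ)))) ∧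
      -- lower bound, uniform over energies in a compact part of the open band
      (∀ a b : ℝ, U xs + γ < a → b < U xs + γ⁻¹ →
        ∃ c : ℝ, 0 < c ∧ c < C ∧ ∃ ε₀ : ℝ, 0 < ε₀ ∧ ∀ ε : ℝ, 0 < ε → ε < ε₀ →
        ∀ x : EuclideanSpace ℝ (Fin N), ZigZag.pd U i x = 0 → a ≤ U x → U x ≤ b →
        ∀ v : EuclideanSpace ℝ (Fin N), (∀ j, v j = 1 ∨ v j = -1) →
          ENNReal.ofReal (c * ε ^ (-(1 / 2) : ℝ))
            ≤ ∫⁻ ω, (ZigZag.flipCount U xs γ ε T i x v ω : ℝ≥0∞) ∂(ZigZag.clockMeasure N)) := by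
  obtain ⟨K, M, η, δ, hC⟩ := hU.exists_controlled hDD hγ0 i
  have hpd := hU.continuous_pd
  have hK := hC.K_pos
  have hM := hC.M_nonneg
  have hη := hC.η_pos
  have hδ := hC.δ_pos
  -- Everything is expressed through r = ε^(1/4), the scale of the supremum; the ring count has
  -- scale r⁻² = ε^(-1/2).
  have hpow : ∀ ε : ℝ, 0 < ε → 0 < ε ^ (1 / 4 : ℝ) ∧ (ε ^ (1 / 4 : ℝ)) ^ 4 = ε ∧
      ((ε ^ (1 / 4 : ℝ)) ^ 2)⁻¹ = ε ^ (-(1 / 2) : ℝ) := by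
    intro ε hε
    refine ⟨Real.rpow_pos_of_pos hε _, ?_, ?_⟩
    · rw [← Real.rpow_natCast, ← Real.rpow_mul hε.le]; norm_num
    · rw [← Real.rpow_natCast, ← Real.rpow_mul hε.le, ← Real.rpow_neg hε.le]; norm_num
  set C₁ := (T + (M + K * T) / 2) / 2 with hC₁
  set C₂ := (1 + M / η) * (1 / 2 + K * C₁) with hC₂
  have hC₁0 : 0 < C₁ := by positivity
  have hC₂0 : 0 < C₂ := by positivity
  refine ⟨C₁ + C₂, by positivity, ⟨1, one_pos, fun ε hε _ x hxi hxa hxb v hv => ?_⟩,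
    fun a b ha hb => ?_⟩
  · obtain ⟨hr, hr4, hr2⟩ := hpow ε hε
    have hx : x ∈ ZigZag.band U xs γ := ⟨hxa.le, hxb.le⟩
    constructor
    · refine (ZigZag.lintegral_flipCount_le hC hpd hv hx hxi hT.le (pow_pos hr 2)
        (by rw [← pow_mul]; exact hr4)).trans (ENNReal.ofReal_le_ofReal ?_)
      rw [hr2]
      gcongr
      linarith
    · refine (ZigZag.lintegral_supPartial_le hC hpd hv hx hxi hT.le hr hr4).trans
        (ENNReal.ofReal_le_ofReal ?_)
      exact mul_le_mul_of_nonneg_right (le_add_of_nonneg_left hC₁0.le) hr.le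
  · obtain ⟨T', hT'0, hT'T, hball⟩ := hU.exists_time ha hb hT
    set C₃ := (T' + (M + K * T') / 2) / 2 with hC₃
    have hC₃0 : 0 < C₃ := by positivity
    set c₀ := (δ * T') ^ 2 / (16 * (K * C₃)) with hc₀
    have hc₀0 : 0 < c₀ := by positivity
    set c₁ := (1 + δ * T' / η) * (K * C₃ + 1 / 2) with hc₁
    have hc₁0 : 0 < c₁ := by positivity
    -- Smallness threshold for r at which `hsmall` holds; ε₀ is its fourth power.
    set r₀ := δ * T' / 4 / c₁ with hr₀
    have hr₀0 : 0 < r₀ := by positivity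
    -- The minimum with half of C is there only to ensure c < C, as C was fixed before a and b.
    refine ⟨min c₀ ((C₁ + C₂) / 2), by positivity, (min_le_right _ _).trans_lt
      (half_lt_self (by positivity)), r₀ ^ 4, by positivity,
      fun ε hε hε0 x hxi hxa hxb v hv => ?_⟩
    obtain ⟨hr, hr4, hr2⟩ := hpow ε hε
    have hx : x ∈ ZigZag.band U xs γ := ⟨ha.le.trans hxa, hxb.trans hb.le⟩
    have hrr : ε ^ (1 / 4 : ℝ) ≤ r₀ := by
      rw [← hr4] at hε0
      exact (lt_of_pow_lt_pow_left₀ 4 hr₀0.le hε0).le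
    have hsmall : c₁ * ε ^ (1 / 4 : ℝ) ≤ δ * T' / 4 := by
      rw [mul_comm]
      exact (le_div_iff₀ hc₁0).1 hrr
    refine le_trans (ENNReal.ofReal_le_ofReal ?_) (ZigZag.le_lintegral_flipCount hC hpd hv hx hxi
      hT'0 hT'T (hball x hxa hxb) hr hr4 hsmall)
    rw [hr2]
    gcongr
    exact min_le_left _ _
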